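/- For a positive integer $n$ let $[n]=\{1,\dots,n\}$. A $3$-graph $G=(V,E)$ consists of a finite vertex set $V$ of positive integers and a set $E$ of $3$-element subsets of $V$. Its Lagrangian is $$\lambda(G)=\max\Big\{\sum_{\{i,j,k\}\in E}x_ix_jx_k \;:\; x_v\ge 0 \text{ for } v\in V,\ \sum_{v\in V}x_v=1\Big\}.$$ A $3$-graph on $[t]$ is left-compressed if, whenever $j_1<j_2<j_3$ form an edge and $i_1<i_2<i_3$ are elements of $[t]$ with $i_p\le j_p$ for $p=1,2,3$, then $\{i_1,i_2,i_3\}$ is an edge. For distinct vertices $u,v$, write $E_{uv}$ for the set of vertices $w$ with $\{u,v,w\}\in E$. In the colex ordering of finite sets of positive integers, $A<B$ means $A\ne B$ and $\max(A\triangle B)\in B$; let $C_{3,m}$ be the $3$-graph whose edges are the first $m$ three-element sets of positive integers in this ordering, and whose vertices are the elements of these edges. **Corollary 3.8.** Let $m,t,b$ be positive integers satisfying $$\binom{t-1}{3}+\binom{t-2}{2}+b<m\le\binom t3 .$$ Let $G=([t],E)$ be a left-compressed $3$-graph with $m$ edges such that $|E_{(t-1)t}|\le b+3$. Then $\lambda(G)\le\lambda(C_{3,m})$.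 -/

import Mathlib

/-- An `r`-uniform graph (`r`-graph) on a finite set of natural numbers: a vertex set `verts`
and a set `edges` of `r`-element subsets of it. -/
structure RGraph (r : ℕ) where
  verts : Finset ℕ
  edges : Finset (Finset ℕ)
  edges_subset : edges ⊆ verts.powersetCard r

namespace RGraph

variable {r : ℕ}

/-- The polynomial `λ(G, x) = ∑_{e ∈ E(G)} ∏_{i ∈ e} x_i`. -/
def weight (G : RGraph r) (x : ℕ → ℝ) : ℝ :=
  ∑ e ∈ G.edges, ∏ i ∈ e, x i

/-- `x` is a legal weighting of `G`: nonnegative weights on the vertices, with sum `1`.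
Only the values of `x` at the vertices of `G` matter. -/
def IsLegal (G : RGraph r) (x : ℕ → ℝ) : Prop :=
  (∀ i ∈ G.verts, 0 ≤ x i) ∧ ∑ i ∈ G.verts, x i = 1

/-- The Lagrangian of `G`: the maximum of `λ(G, x)` over all legal weightings `x`
(attained as soon as `G` has a vertex, see `isGreatest_lagrangian`). -/
noncomputable def lagrangian (G : RGraph r) : ℝ :=
  sSup (G.weight '' {x | G.IsLegal x})

theorem isGreatest_lagrangian (G : RGraph r) (hG : G.verts.Nonempty) :
    IsGreatest (G.weight '' {x | G.IsLegal x}) G.lagrangian := by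
  set K : Set (ℕ → ℝ) := (Set.univ.pi fun i => if i ∈ G.verts then Set.Icc 0 1 else {0}) ∩
    {x | ∑ i ∈ G.verts, x i = 1} with hK
  have hcomp : IsCompact K := by
    refine IsCompact.inter_right (isCompact_univ_pi fun i => ?_) ?_
    · by_cases h : i ∈ G.verts
      · simpa [h] using isCompact_Icc
      · simp [h]
    · exact isClosed_eq (by fun_prop) continuous_const
  have himg : G.weight '' {x | G.IsLegal x} = G.weight '' K := by
    apply Set.Subset.antisymm
    · rintro _ ⟨x, ⟨h0, h1⟩, rfl⟩
      refine ⟨fun i => if i ∈ G.verts then x i else 0, ⟨?_, ?_⟩, ?_⟩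
      · intro i _
        by_cases h : i ∈ G.verts
        · simp only [h, if_true]
          exact ⟨h0 i h, h1 ▸ Finset.single_le_sum h0 h⟩
        · simp [h]
      · show ∑ i ∈ G.verts, (if i ∈ G.verts then x i else 0) = 1
        rw [← h1]
        exact Finset.sum_congr rfl fun i hi => if_pos hi
      · refine Finset.sum_congr rfl fun e he => Finset.prod_congr rfl fun i hi => ?_
        exact if_pos ((Finset.mem_powersetCard.1 (G.edges_subset he)).1 hi)
    · rintro _ ⟨x, ⟨h0, h1⟩, rfl⟩
      refine ⟨x, ⟨fun i hi => ?_, h1⟩, rfl⟩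
      have := h0 i (Set.mem_univ i)
      simp only [hi, if_true] at this
      exact this.1
  have hne : (G.weight '' K).Nonempty := by
    rw [← himg]
    obtain ⟨v, hv⟩ := hG
    refine ⟨_, fun i => if i = v then 1 else 0, ⟨fun i _ => ?_, ?_⟩, rfl⟩
    · show (0 : ℝ) ≤ if i = v then 1 else 0
      split_ifs <;> norm_num
    · simp [hv]
  have hcont : Continuous G.weight := by
    unfold weight
    fun_prop
  have := (hcomp.image hcont).isGreatest_sSup hne
  rwa [← himg] at this

/-- `G` is left-compressed: if `j₁ < ⋯ < j_r` is an edge and `i₁ < ⋯ < i_r` are vertices with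
`i_p ≤ j_p` for every `p`, then `i₁ ⋯ i_r` is an edge. -/
def LeftCompressed (G : RGraph r) : Prop :=
  ∀ i j : Fin r → ℕ, StrictMono i → StrictMono j → (∀ p, i p ∈ G.verts) → (∀ p, i p ≤ j p) →
    Finset.univ.image j ∈ G.edges → Finset.univ.image i ∈ G.edges

/-- The neighbourhood `E_{uv}` of a pair: all `(r-2)`-sets `B` of vertices such that
`B ∪ {u, v}` is an edge. -/
def pairNbhd (G : RGraph r) (u v : ℕ) : Finset (Finset ℕ) :=
  G.verts.powerset.filter fun B => B.card + 2 = r ∧ B ∪ {u, v} ∈ G.edges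

end RGraph

/-- The first `m` sets, in the colex ordering, among the `r`-element sets of positive integers:
those which have fewer than `m` predecessors. For `r ≥ 1` they all lie in `{1, …, m + r}`; see
`card_colexEdges` and `mem_colexEdges_of_lt`. -/
def colexEdges (r m : ℕ) : Finset (Finset ℕ) :=
  ((Finset.Icc 1 (m + r)).powersetCard r).filter fun A =>
    (((Finset.Icc 1 (m + r)).powersetCard r).filter fun B => toColex B < toColex A).card < m

theorem card_colexEdges {r : ℕ} (hr : 0 < r) (m : ℕ) : (colexEdges r m).card = m := by
  unfold colexEdges
  set S := (Finset.Icc 1 (m + r)).powersetCard r with hS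
  have hcard : m ≤ S.card := by
    rw [hS, Finset.card_powersetCard, Nat.card_Icc, Nat.add_sub_cancel]
    obtain ⟨s, rfl⟩ : ∃ s, r = s + 1 := ⟨r - 1, by omega⟩
    clear hS hr
    clear S
    induction m with
    | zero => exact Nat.zero_le _
    | succ k ih =>
      have h1 : k + 1 + (s + 1) = (k + (s + 1)) + 1 := by omega
      rw [h1, Nat.choose_succ_succ']
      have : 0 < (k + (s + 1)).choose s := Nat.choose_pos (by omega)
      omega
  set f : Finset ℕ → ℕ := fun A => (S.filter fun B => toColex B < toColex A).card with hf
  have hlt : ∀ A ∈ S, ∀ B ∈ S, toColex A < toColex B → f A < f B := by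
    intro A hA B hB h
    refine Finset.card_lt_card (Finset.ssubset_iff_of_subset ?_ |>.2 ⟨A, ?_, ?_⟩)
    · intro D hD
      rw [Finset.mem_filter] at hD ⊢
      exact ⟨hD.1, hD.2.trans h⟩
    · exact Finset.mem_filter.2 ⟨hA, h⟩
    · simp
  have hinj : Set.InjOn f S := by
    intro A hA B hB h
    rcases lt_trichotomy (toColex A) (toColex B) with h' | h' | h'
    · exact absurd h (hlt A hA B hB h').ne
    · simpa using h'
    · exact absurd h (hlt B hB A hA h').ne'
  have himg : S.image f = Finset.range S.card := by
    apply Finset.eq_of_subset_of_card_le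
    · intro k hk
      obtain ⟨A, hA, rfl⟩ := Finset.mem_image.1 hk
      refine Finset.mem_range.2 (Finset.card_lt_card ?_)
      exact Finset.filter_ssubset.2 ⟨A, hA, lt_irrefl _⟩
    · rw [Finset.card_range, Finset.card_image_of_injOn hinj]
  have h2 : (S.filter fun A => f A < m).image f = Finset.range m := by
    ext k
    simp only [Finset.mem_image, Finset.mem_filter, Finset.mem_range]
    constructor
    · rintro ⟨A, ⟨_, h⟩, rfl⟩
      exact h
    · intro hk
      have : k ∈ S.image f := by
        rw [himg]
        exact Finset.mem_range.2 (by omega)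
      obtain ⟨A, hA, rfl⟩ := Finset.mem_image.1 this
      exact ⟨A, ⟨hA, hk⟩, rfl⟩
  rw [← Finset.card_image_of_injOn (hinj.mono (Finset.coe_subset.2 (Finset.filter_subset _ _))),
    h2, Finset.card_range]

theorem mem_colexEdges_of_lt {r m : ℕ} {A B : Finset ℕ} (hA : A ∈ colexEdges r m)
    (hB : B.card = r) (hpos : ∀ i ∈ B, 0 < i) (h : toColex B < toColex A) :
    B ∈ colexEdges r m := by
  unfold colexEdges at hA ⊢
  rw [Finset.mem_filter, Finset.mem_powersetCard] at hA
  rw [Finset.mem_filter, Finset.mem_powersetCard]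
  refine ⟨⟨fun i hi => Finset.mem_Icc.2 ⟨hpos i hi, ?_⟩, hB⟩, lt_of_le_of_lt ?_ hA.2⟩
  · exact Finset.Colex.forall_le_mono h.le (fun b hb => (Finset.mem_Icc.1 (hA.1.1 hb)).2) i hi
  · refine Finset.card_le_card fun D hD => ?_
    rw [Finset.mem_filter] at hD ⊢
    exact ⟨hD.1, hD.2.trans h⟩

/-- The `r`-graph `C_{r,m}` formed by the first `m` sets in the colex ordering of the `r`-sets of
positive integers; its vertices are the elements of its edges. -/
def colexGraph (r m : ℕ) : RGraph r where
  verts := (colexEdges r m).biUnion id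
  edges := colexEdges r m
  edges_subset := fun _ hA => Finset.mem_powersetCard.2
    ⟨Finset.subset_biUnion_of_mem id hA,
      (Finset.mem_powersetCard.1 (Finset.mem_filter.1 hA).1).2⟩

/-! Write `t = u + 2` and `m = (u + 1).choose 3 + u.choose 2 + c`, so that `b < c ≤ u`. Then
`C_{3,m}` is the complete 3-graph on `[t]` without the triples `{i, t-1, t}`, `i > c`, and `G` lacks
equally many triples, namely `u - c`. Non-edges of a left-compressed graph are closed under moving
up componentwise. Hence the non-edges of `G` through `t-1` and `t` are the `{i, t-1, t}` with `i > s
= |E_{(t-1)t}|`, and the set `X` of all other non-edges has `s - c ≤ (b + 3) - (b + 1) = 2`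
elements. Up-closure leaves four possibilities: `X` is empty and `G = C_{3,m}`; `X` consists of
`{t-3, t-2, t}` alone; or `X` contains this triple and one of `{t-4, t-2, t}`, `{t-3, t-2, t-1}`.

In the last three cases `C_{3,m}` arises from `G` by adding `X` and deleting one or two triples `{i,
t-1, t}`. For a fixed weighting this exchange may lose weight, so an optimal weighting of `G` is
perturbed at the same time. If some optimal weight is zero, it can be moved to vertex `t`, where
nothing that `C_{3,m}` lacks matters (`lagrangian_le_of_forall_pos`). If all are positive, the
first-order conditions order the weights and bound the loss; they also cancel the linear effect of a
perturbation on the weight of `G`, so a suitable small shift gains more through the exchanged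
triples than it costs to second order. The inequalities are `exists_weightA_le`, `exists_weightB_le`
and `exists_weightC_le`, one for each nonempty shape of `X`. -/

/-! ### First-order conditions and the three perturbation inequalities -/

/-- Testing with `δ = θ * c` for small `θ > 0` makes the linear term dominate. Moving `δ` from one
vertex to another changes the weight by a quadratic polynomial in `δ`, so at an interior maximum
this yields the vanishing of the linear coefficient. -/
theorem eq_zero_of_mul_le_mul_sq {c k η : ℝ} (hη : 0 < η)
    (h : ∀ δ, |δ| ≤ η → c * δ ≤ k * δ ^ 2) : c = 0 := by
  by_contra hc
  have hc2 : 0 < c ^ 2 := by positivity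
  set θ : ℝ := min (η / |c|) (1 / (2 * (|k| + 1))) with hθ
  have hcp : 0 < |c| := abs_pos.2 hc
  have hk := abs_nonneg k
  have hθp : 0 < θ := lt_min (by positivity) (by positivity)
  have h1 : |θ * c| ≤ η := by
    rw [abs_mul, abs_of_pos hθp]
    calc θ * |c| ≤ η / |c| * |c| := by gcongr; exact min_le_left _ _
      _ = η := by field_simp
  have h2 := h _ h1
  have h3 : θ * (|k| + 1) ≤ 1 / 2 := by
    calc θ * (|k| + 1) ≤ 1 / (2 * (|k| + 1)) * (|k| + 1) := by gcongr; exact min_le_right _ _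
      _ = 1 / 2 := by field_simp
  have h4 : k * θ < 1 := by nlinarith [le_abs_self k]
  have h5 : 0 < θ * c ^ 2 := by positivity
  nlinarith

/-- The weight of a `3`-graph missing the triples `{i, w, z}` for `i` in a set of weight `M` or
`i = p, q`, and the triple `pqz`; the other vertices have symmetric functions `e₁, e₂, e₃`. -/
noncomputable def weightA (e₁ e₂ e₃ M a p q w z : ℝ) : ℝ :=
  e₃ + e₂ * (a + p + q + w + z)
    + e₁ * (a * p + a * q + a * w + a * z + p * q + p * w + p * z + q * w + q * z + w * z)
    + (a * p * q + a * p * w + a * p * z + a * q * w + a * q * z + a * w * z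
      + p * q * w + p * q * z + p * w * z + q * w * z)
    - w * z * (M + p + q) - p * q * z

/-- Stationarity gives `p = q` and `z ≤ w ≤ q ≤ a`, and makes `a - q` of order `z * (w + q)`. The
exchange of `awz` for `pqz` therefore loses only `z * (w * a - q ^ 2)`, which is recovered by moving
`ε` from `a` to `p` and `ε` from `w` to `q`. -/
theorem exists_weightA_le {e₁ e₂ e₃ M a p q w z : ℝ} (ha : 0 < a) (hp : 0 < p) (hq : 0 < q)
    (hw : 0 < w) (hz : 0 < z) (hM : 0 ≤ M) (hMe : M ≤ e₁) (hsum : e₁ + a + p + q + w + z = 1)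
    (hopt : ∀ a' p' q' w' z', 0 ≤ a' → 0 ≤ p' → 0 ≤ q' → 0 ≤ w' → 0 ≤ z' →
      a' + p' + q' + w' + z' = a + p + q + w + z →
      weightA e₁ e₂ e₃ M a' p' q' w' z' ≤ weightA e₁ e₂ e₃ M a p q w z) :
    ∃ a' p' q' w', 0 ≤ a' ∧ 0 ≤ p' ∧ 0 ≤ q' ∧ 0 ≤ w' ∧
      a' + p' + q' + w' = a + p + q + w ∧
      weightA e₁ e₂ e₃ M a p q w z ≤
        weightA e₁ e₂ e₃ M a' p' q' w' z + p' * q' * z - w' * z * a' := by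
  obtain ⟨η, hη, ha', hp', hq', hw', hz'⟩ :
      ∃ η > 0, η ≤ a ∧ η ≤ p ∧ η ≤ q ∧ η ≤ w ∧ η ≤ z :=
    ⟨min a (min p (min q (min w z))), by simp [*], by simp, by simp, by simp, by simp, by simp⟩
  -- Each of the following identities expresses equality of two partial derivatives; `η` is at most
  -- every weight, so transfers of size `|δ| ≤ η` keep the weights nonnegative.
  have hpq : (q - p) * (1 - p - q - z) = 0 :=
    eq_zero_of_mul_le_mul_sq (k := 1 - p - q - z) hη fun δ hδ => by
      obtain ⟨h1, h2⟩ := abs_le.1 hδ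
      have := hopt a (p + δ) (q - δ) w z ha.le (by linarith) (by linarith) hw.le hz.le (by ring)
      unfold weightA at this
      obtain rfl : e₁ = 1 - (a + p + q + w + z) := by linarith
      linarith
  have hap : (p - a) * (1 - a - p) + z * (w + q) = 0 :=
    eq_zero_of_mul_le_mul_sq (k := 1 - a - p) hη fun δ hδ => by
      obtain ⟨h1, h2⟩ := abs_le.1 hδ
      have := hopt (a + δ) (p - δ) q w z (by linarith) (by linarith) hq.le hw.le hz.le (by ring)
      unfold weightA at this
      obtain rfl : e₁ = 1 - (a + p + q + w + z) := by linarith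
      linarith
  have hpw : (w - p) * (1 - p - w - z) + z * M = 0 :=
    eq_zero_of_mul_le_mul_sq (k := 1 - p - w - z) hη fun δ hδ => by
      obtain ⟨h1, h2⟩ := abs_le.1 hδ
      have := hopt a (p + δ) q (w - δ) z ha.le (by linarith) hq.le (by linarith) hz.le (by ring)
      unfold weightA at this
      obtain rfl : e₁ = 1 - (a + p + q + w + z) := by linarith
      linarith
  have hwz : (z - w) * (e₁ - M + a) + p * q = 0 :=
    eq_zero_of_mul_le_mul_sq (k := e₁ - M + a) hη fun δ hδ => by
      obtain ⟨h1, h2⟩ := abs_le.1 hδ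
      have := hopt a p q (w + δ) (z - δ) ha.le hp.le hq.le (by linarith) (by linarith) (by ring)
      unfold weightA at this
      linarith
  obtain rfl : q = p := by
    rcases mul_eq_zero.1 hpq with h | h <;> linarith
  have hR : 0 < 1 - a - q := by linarith
  have hS : 0 < 1 - q - w - z := by linarith
  have hzw : z ≤ w := by
    by_contra! h
    have := mul_pos (sub_pos.2 h) (show 0 < e₁ - M + a by linarith)
    nlinarith
  have hwq : w ≤ q := by
    by_contra! h
    have := mul_pos (sub_pos.2 h) hS
    nlinarith
  have hqa : q ≤ a := by
    by_contra! h
    have := mul_pos (sub_pos.2 h) hR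
    nlinarith
  -- This is what gives `K ≤ 2 * (1 - a - q)` below. The bounds on `a - q` and `q - w` from
  -- stationarity are added after clearing the denominators `1 - a - q` and `1 - q - w - z`.
  have hkey : a ≤ w + z := by
    have h1 : (a - q) * (1 - a - q) * (1 - q - w - z) = z * (w + q) * (1 - q - w - z) := by
      rw [show (a - q) * (1 - a - q) = z * (w + q) by linarith]
    have h2 : (q - w) * (1 - q - w - z) ≤ z * ((1 - q - w - z) - (a + q)) := by
      have : z * M ≤ z * ((1 - q - w - z) - (a + q)) := by gcongr; linarith
      linarith
    have h3 : (w + q) * (1 - q - w - z) ≤ (a + q) * (1 - a - q) := by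
      have := mul_nonneg (show 0 ≤ a - w by linarith) (show 0 ≤ 1 - (a + q) - (w + q) by linarith)
      nlinarith
    have h4 := mul_le_mul_of_nonneg_left h3 hz.le
    have h5 := mul_le_mul_of_nonneg_right h2 hR.le
    have h6 : (a - w - z) * ((1 - a - q) * (1 - q - w - z)) ≤ 0 := by linarith
    by_contra! h
    have := mul_pos (show 0 < a - w - z by linarith) (mul_pos hR hS)
    linarith
  obtain ⟨T, hT⟩ : ∃ T, T = w + 2 * q + a := ⟨_, rfl⟩
  obtain ⟨K, hK⟩ : ∃ K, K = 2 - T - z := ⟨_, rfl⟩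
  have hKp : 1 ≤ K := by linarith
  -- The vertex of the parabola `ε * z * T - ε ^ 2 * K`, the net gain of the shift.
  obtain ⟨ε, hε⟩ : ∃ ε, ε = z * T / (2 * K) := ⟨_, rfl⟩
  have hεK : ε * (2 * K) = z * T := by rw [hε]; field_simp
  have hε0 : 0 ≤ ε := by rw [hε]; have : 0 < T := by linarith
                         positivity
  have hεz : ε ≤ z := by
    rw [hε, div_le_iff₀ (by positivity)]
    gcongr
    linarith
  refine ⟨a - ε, q + ε, q + ε, w - ε, by linarith, by linarith, by linarith, by linarith, by ring, ?_⟩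
  -- The linear term `ε * z * T` comes from the exchanged triples alone; that of `weightA` vanishes
  -- by `hpw` and `hap`.
  have hid : weightA e₁ e₂ e₃ M (a - ε) (q + ε) (q + ε) (w - ε) z + (q + ε) * (q + ε) * z
      - (w - ε) * z * (a - ε) - weightA e₁ e₂ e₃ M a q q w z
      = z * (q ^ 2 - w * a) + ε * z * T - ε ^ 2 * K := by
    obtain rfl : e₁ = 1 - (a + q + q + w + z) := by linarith
    unfold weightA
    rw [hK, hT]
    linear_combination ε * (hpw - hap)
  -- At the vertex of the parabola the claim becomes `4 * K * (w * a - q ^ 2) ≤ z * T ^ 2`.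
  have hfin : 0 ≤ z * (q ^ 2 - w * a) + ε * z * T - ε ^ 2 * K := by
    have h1 : 8 * w * (w + q) ≤ T ^ 2 := by
      have h2 : (w + 3 * q) ^ 2 ≤ T ^ 2 := by gcongr; linarith
      nlinarith [mul_nonneg (sub_nonneg.2 hwq) (show 0 ≤ 9 * q + 7 * w by linarith)]
    have h3 : (1 - a - q) * (w * a - q ^ 2) ≤ w * (z * (w + q)) := by
      have : 0 ≤ (1 - a - q) * (q * (q - w)) := by
        have := sub_nonneg.2 hwq
        positivity
      have h4 : (a - q) * (1 - a - q) = z * (w + q) := by linarith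
      rw [← h4]
      linarith
    have h5 : (1 - a - q) * (4 * K * (w * a - q ^ 2)) ≤ (1 - a - q) * (z * T ^ 2) :=
      calc (1 - a - q) * (4 * K * (w * a - q ^ 2))
          = 4 * K * ((1 - a - q) * (w * a - q ^ 2)) := by ring
        _ ≤ 4 * K * (w * (z * (w + q))) := by gcongr
        _ ≤ 4 * (2 * (1 - a - q)) * (w * (z * (w + q))) := by gcongr; linarith
        _ = (1 - a - q) * (z * (8 * w * (w + q))) := by ring
        _ ≤ (1 - a - q) * (z * T ^ 2) := by gcongr
    have h6 := le_of_mul_le_mul_left h5 hR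
    have h7 : 4 * K * (z * (q ^ 2 - w * a) + ε * z * T - ε ^ 2 * K)
        = z * (z * T ^ 2 - 4 * K * (w * a - q ^ 2)) := by
      linear_combination (z * T - ε * (2 * K)) * hεK
    have h8 : 0 ≤ z * (z * T ^ 2 - 4 * K * (w * a - q ^ 2)) :=
      mul_nonneg hz.le (by linarith)
    rw [← h7] at h8
    exact nonneg_of_mul_nonneg_right h8 (by positivity)
  linarith

/-- The weight of a `3`-graph missing the triples `{i, w, z}` for `i` in a set of weight `M` or
`i = p, q, r`, and the triples `prz` and `qrz`. -/
noncomputable def weightB (e₁ e₂ e₃ M a b p q r w z : ℝ) : ℝ :=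
  e₃ + e₂ * (a + b + p + q + r + w + z)
    + e₁ * (a * b + (a + b) * (p + q + r + w + z) + p * q + (p + q) * (r + w + z) + r * w + r * z
      + w * z)
    + (a * b * (p + q + r + w + z) + (a + b) * (p * q + (p + q) * (r + w + z) + r * w + r * z
      + w * z) + p * q * (r + w + z) + (p + q) * (r * w + r * z + w * z) + r * w * z)
    - w * z * (M + p + q + r) - (p + q) * r * z

/-- The same scheme: stationarity gives `a = b`, `p = q` and `z ≤ w ≤ r ≤ q ≤ b`. The shift takes
`ε` from each of `a`, `b` to `p`, `q`, and `2ε` from `w` to `r`, leaving `z` alone. -/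
theorem exists_weightB_le {e₁ e₂ e₃ M a b p q r w z : ℝ} (ha : 0 < a) (hb : 0 < b) (hp : 0 < p)
    (hq : 0 < q) (hr : 0 < r) (hw : 0 < w) (hz : 0 < z) (hM : 0 ≤ M) (hMe : M ≤ e₁)
    (hsum : e₁ + a + b + p + q + r + w + z = 1)
    (hopt : ∀ a' b' p' q' r' w' z', 0 ≤ a' → 0 ≤ b' → 0 ≤ p' → 0 ≤ q' → 0 ≤ r' → 0 ≤ w' →
      0 ≤ z' → a' + b' + p' + q' + r' + w' + z' = a + b + p + q + r + w + z →
      weightB e₁ e₂ e₃ M a' b' p' q' r' w' z' ≤ weightB e₁ e₂ e₃ M a b p q r w z) :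
    ∃ a' b' p' q' r' w', 0 ≤ a' ∧ 0 ≤ b' ∧ 0 ≤ p' ∧ 0 ≤ q' ∧ 0 ≤ r' ∧ 0 ≤ w' ∧
      a' + b' + p' + q' + r' + w' = a + b + p + q + r + w ∧
      weightB e₁ e₂ e₃ M a b p q r w z ≤
        weightB e₁ e₂ e₃ M a' b' p' q' r' w' z + (p' + q') * r' * z - w' * z * (a' + b') := by
  obtain ⟨η, hη, ha', hb', hp', hq', hr', hw', hz'⟩ :
      ∃ η > 0, η ≤ a ∧ η ≤ b ∧ η ≤ p ∧ η ≤ q ∧ η ≤ r ∧ η ≤ w ∧ η ≤ z :=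
    ⟨min a (min b (min p (min q (min r (min w z))))), by simp [*], by simp, by simp, by simp,
      by simp, by simp, by simp, by simp⟩
  have hab : (b - a) * (1 - a - b) = 0 :=
    eq_zero_of_mul_le_mul_sq (k := 1 - a - b) hη fun δ hδ => by
      obtain ⟨h1, h2⟩ := abs_le.1 hδ
      have := hopt (a + δ) (b - δ) p q r w z (by linarith) (by linarith) hp.le hq.le hr.le hw.le
        hz.le (by ring)
      unfold weightB at this
      obtain rfl : e₁ = 1 - (a + b + p + q + r + w + z) := by linarith
      linarith
  have hpq : (q - p) * (1 - p - q) = 0 :=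
    eq_zero_of_mul_le_mul_sq (k := 1 - p - q) hη fun δ hδ => by
      obtain ⟨h1, h2⟩ := abs_le.1 hδ
      have := hopt a b (p + δ) (q - δ) r w z ha.le hb.le (by linarith) (by linarith) hr.le hw.le
        hz.le (by ring)
      unfold weightB at this
      obtain rfl : e₁ = 1 - (a + b + p + q + r + w + z) := by linarith
      linarith
  have hap : (p - a) * (1 - a - p) + z * (w + r) = 0 :=
    eq_zero_of_mul_le_mul_sq (k := 1 - a - p) hη fun δ hδ => by
      obtain ⟨h1, h2⟩ := abs_le.1 hδ
      have := hopt (a + δ) b (p - δ) q r w z (by linarith) hb.le (by linarith) hq.le hr.le hw.le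
        hz.le (by ring)
      unfold weightB at this
      obtain rfl : e₁ = 1 - (a + b + p + q + r + w + z) := by linarith
      linarith
  have hpr : (r - p) * (1 - p - r - z) + q * z = 0 :=
    eq_zero_of_mul_le_mul_sq (k := 1 - p - r - z) hη fun δ hδ => by
      obtain ⟨h1, h2⟩ := abs_le.1 hδ
      have := hopt a b (p + δ) q (r - δ) w z ha.le hb.le (by linarith) hq.le (by linarith) hw.le
        hz.le (by ring)
      unfold weightB at this
      obtain rfl : e₁ = 1 - (a + b + p + q + r + w + z) := by linarith
      linarith
  have hrw : (w - r) * (1 - r - w - z) + z * M = 0 :=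
    eq_zero_of_mul_le_mul_sq (k := 1 - r - w - z) hη fun δ hδ => by
      obtain ⟨h1, h2⟩ := abs_le.1 hδ
      have := hopt a b p q (r + δ) (w - δ) z ha.le hb.le hp.le hq.le (by linarith) (by linarith)
        hz.le (by ring)
      unfold weightB at this
      obtain rfl : e₁ = 1 - (a + b + p + q + r + w + z) := by linarith
      linarith
  have hwz : (z - w) * (e₁ - M + a + b) + (p + q) * r = 0 :=
    eq_zero_of_mul_le_mul_sq (k := e₁ - M + a + b) hη fun δ hδ => by
      obtain ⟨h1, h2⟩ := abs_le.1 hδ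
      have := hopt a b p q r (w + δ) (z - δ) ha.le hb.le hp.le hq.le hr.le (by linarith)
        (by linarith) (by ring)
      unfold weightB at this
      linarith
  obtain rfl : b = a := by
    rcases mul_eq_zero.1 hab with h | h <;> linarith
  obtain rfl : q = p := by
    rcases mul_eq_zero.1 hpq with h | h <;> linarith
  have hzw : z ≤ w := by
    by_contra! h
    have := mul_pos (sub_pos.2 h) (show 0 < e₁ - M + b + b by linarith)
    nlinarith [mul_pos hq hr]
  have hR : 0 < 1 - b - q := by linarith
  have hwr : w ≤ r := by
    by_contra! h
    have := mul_pos (sub_pos.2 h) (show 0 < 1 - r - w - z by linarith)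
    nlinarith
  have hrq : r ≤ q := by
    by_contra! h
    have := mul_pos (sub_pos.2 h) (show 0 < 1 - q - r - z by linarith)
    nlinarith
  have hqb : q ≤ b := by
    by_contra! h
    have := mul_pos (sub_pos.2 h) hR
    nlinarith
  -- For small, nearly equal weights the gain is about `12 * z * w * ε - 6 * ε ^ 2`, which is
  -- largest at this value.
  obtain ⟨ε, hε⟩ : ∃ ε, ε = z * w := ⟨_, rfl⟩
  have hε0 : 0 ≤ ε := by rw [hε]; positivity
  have hεw : 2 * ε ≤ w := by
    have : z * w ≤ 1 / 2 * w := by gcongr; linarith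
    linarith
  refine ⟨b - ε, b - ε, q + ε, q + ε, r + 2 * ε, w - 2 * ε, by linarith, by linarith, by linarith,
    by linarith, by linarith, by linarith, by ring, ?_⟩
  have hid : weightB e₁ e₂ e₃ M (b - ε) (b - ε) (q + ε) (q + ε) (r + 2 * ε) (w - 2 * ε) z
      + ((q + ε) + (q + ε)) * (r + 2 * ε) * z
      - (w - 2 * ε) * z * ((b - ε) + (b - ε)) - weightB e₁ e₂ e₃ M b b q q r w z
      = 2 * z * (q * r - w * b) + ε * z * (2 * w + 4 * b + 4 * q + 2 * r)
        - ε ^ 2 * (6 - 2 * b - 4 * w - 4 * r - 2 * q - 4 * z) := by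
    obtain rfl : e₁ = 1 - (b + b + q + q + r + w + z) := by linarith
    unfold weightB
    linear_combination 2 * ε * (hrw - hap)
  have h1 : (1 - b - q) * (w * b - q * r) ≤ w * (z * (w + r)) := by
    have : 0 ≤ (1 - b - q) * (q * (r - w)) := by
      have := sub_nonneg.2 hwr
      positivity
    have h4 : (b - q) * (1 - b - q) = z * (w + r) := by linarith
    rw [← h4]
    linarith
  -- Enough for the claim: `h1` bounds the loss by a multiple of `w + r`, and after `ε = z * w` the
  -- net gain is at least a multiple of `4 * b + 4 * q + 2 * r - 4 * w`.
  have h2 : 2 * (w + r) ≤ (1 - b - q) * (4 * b + 4 * q + 2 * r - 4 * w) := by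
    have h3 : 2 * (b + q) + r + w ≤ 1 := by linarith
    -- For small `b + q` the ordering of the weights suffices; for large `b + q` the total weight
    -- forces `r + w ≤ 1 - 2 * (b + q)`.
    rcases le_total (b + q) (1 / 3) with h | h
    · have := mul_nonneg (sub_nonneg.2 h) (show 0 ≤ 4 * b + 4 * q + 2 * r - 4 * w by linarith)
      linarith
    · have h4 := mul_nonneg hR.le (show 0 ≤ 4 * b + 4 * q + 2 * r - 4 * w - (6 * (b + q) - 1) by
        linarith)
      have h5 := mul_nonneg (sub_nonneg.2 h) (show 0 ≤ 3 / 2 - (b + q) by linarith)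
      linarith
  have h3 : (1 - b - q) * (2 * (w * b - q * r))
      ≤ (1 - b - q) * (z * w * (4 * b + 4 * q + 2 * r - 4 * w)) := by
    have := mul_le_mul_of_nonneg_left h2 (show 0 ≤ z * w by positivity)
    linarith
  have h4 := mul_le_mul_of_nonneg_left (le_of_mul_le_mul_left h3 hR) hz.le
  have h5 : 0 ≤ ε ^ 2 * (2 * b + 4 * w + 4 * r + 2 * q + 4 * z) := by positivity
  have h6 : ε * z * (6 * w) = 6 * ε ^ 2 := by rw [hε]; ring
  rw [hε] at h5 h6 hid ⊢
  linarith

/-- The weight of a `3`-graph missing the triples `{i, w, z}` for `i` in a set of weight `M` or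
`i = p, q`, and the triples `pqz` and `pqw`. -/
noncomputable def weightC (e₁ e₂ e₃ M a b p q w z : ℝ) : ℝ :=
  e₃ + e₂ * (a + b + p + q + w + z)
    + e₁ * (a * b + (a + b) * (p + q + w + z) + p * q + (p + q) * (w + z) + w * z)
    + (a * b * (p + q + w + z) + (a + b) * (p * q + (p + q) * (w + z) + w * z)
      + p * q * (w + z) + (p + q) * (w * z))
    - w * z * (M + p + q) - p * q * (w + z)

/-- Here `w` and `z` play symmetric roles, so stationarity gives `w = z` besides `a = b` and `p =
q`, and `z ≤ q ≤ b`. The shift takes `ε` from each of `a`, `b`, `w`, `z` and gives `2ε` to each of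
`p`, `q`. -/
theorem exists_weightC_le {e₁ e₂ e₃ M a b p q w z : ℝ} (ha : 0 < a) (hb : 0 < b) (hp : 0 < p)
    (hq : 0 < q) (hw : 0 < w) (hz : 0 < z) (hM : 0 ≤ M) (hMe : M ≤ e₁)
    (hsum : e₁ + a + b + p + q + w + z = 1)
    (hopt : ∀ a' b' p' q' w' z', 0 ≤ a' → 0 ≤ b' → 0 ≤ p' → 0 ≤ q' → 0 ≤ w' →
      0 ≤ z' → a' + b' + p' + q' + w' + z' = a + b + p + q + w + z →
      weightC e₁ e₂ e₃ M a' b' p' q' w' z' ≤ weightC e₁ e₂ e₃ M a b p q w z) :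
    ∃ a' b' p' q' w' z', 0 ≤ a' ∧ 0 ≤ b' ∧ 0 ≤ p' ∧ 0 ≤ q' ∧ 0 ≤ w' ∧ 0 ≤ z' ∧
      a' + b' + p' + q' + w' + z' = a + b + p + q + w + z ∧
      weightC e₁ e₂ e₃ M a b p q w z ≤
        weightC e₁ e₂ e₃ M a' b' p' q' w' z' + p' * q' * (w' + z') - w' * z' * (a' + b') := by
  obtain ⟨η, hη, ha', hb', hp', hq', hw', hz'⟩ :
      ∃ η > 0, η ≤ a ∧ η ≤ b ∧ η ≤ p ∧ η ≤ q ∧ η ≤ w ∧ η ≤ z :=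
    ⟨min a (min b (min p (min q (min w z)))), by simp [*], by simp, by simp, by simp,
      by simp, by simp, by simp⟩
  have hab : (b - a) * (1 - a - b) = 0 :=
    eq_zero_of_mul_le_mul_sq (k := 1 - a - b) hη fun δ hδ => by
      obtain ⟨h1, h2⟩ := abs_le.1 hδ
      have := hopt (a + δ) (b - δ) p q w z (by linarith) (by linarith) hp.le hq.le hw.le
        hz.le (by ring)
      unfold weightC at this
      obtain rfl : e₁ = 1 - (a + b + p + q + w + z) := by linarith
      linarith
  have hpq : (q - p) * (1 - p - q - w - z) = 0 :=
    eq_zero_of_mul_le_mul_sq (k := 1 - p - q - w - z) hη fun δ hδ => by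
      obtain ⟨h1, h2⟩ := abs_le.1 hδ
      have := hopt a b (p + δ) (q - δ) w z ha.le hb.le (by linarith) (by linarith) hw.le
        hz.le (by ring)
      unfold weightC at this
      obtain rfl : e₁ = 1 - (a + b + p + q + w + z) := by linarith
      linarith
  have hwz : (z - w) * (e₁ - M + a + b) = 0 :=
    eq_zero_of_mul_le_mul_sq (k := e₁ - M + a + b) hη fun δ hδ => by
      obtain ⟨h1, h2⟩ := abs_le.1 hδ
      have := hopt a b p q (w + δ) (z - δ) ha.le hb.le hp.le hq.le (by linarith) (by linarith)
        (by ring)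
      unfold weightC at this
      linarith
  have hap : (p - a) * (1 - a - p) + w * z + q * (w + z) = 0 :=
    eq_zero_of_mul_le_mul_sq (k := 1 - a - p) hη fun δ hδ => by
      obtain ⟨h1, h2⟩ := abs_le.1 hδ
      have := hopt (a + δ) b (p - δ) q w z (by linarith) hb.le (by linarith) hq.le hw.le
        hz.le (by ring)
      unfold weightC at this
      obtain rfl : e₁ = 1 - (a + b + p + q + w + z) := by linarith
      linarith
  have hpw : (w - p) * (1 - p - q - w - z) + z * M = 0 :=
    eq_zero_of_mul_le_mul_sq (k := 1 - p - q - w - z) hη fun δ hδ => by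
      obtain ⟨h1, h2⟩ := abs_le.1 hδ
      have := hopt a b (p + δ) q (w - δ) z ha.le hb.le (by linarith) hq.le (by linarith)
        hz.le (by ring)
      unfold weightC at this
      obtain rfl : e₁ = 1 - (a + b + p + q + w + z) := by linarith
      linarith
  obtain rfl : b = a := by
    rcases mul_eq_zero.1 hab with h | h <;> linarith
  obtain rfl : q = p := by
    rcases mul_eq_zero.1 hpq with h | h <;> linarith
  obtain rfl : z = w := by
    rcases mul_eq_zero.1 hwz with h | h <;> linarith
  have hS : 0 < 1 - q - q - z - z := by linarith
  have hzq : z ≤ q := by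
    by_contra! h
    have := mul_pos (sub_pos.2 h) hS
    nlinarith
  have hqb : q ≤ b := by
    by_contra! h
    have := mul_pos (sub_pos.2 h) (show 0 < 1 - b - q by linarith)
    nlinarith
  obtain ⟨R, hR⟩ : ∃ R, R = 1 - b - q := ⟨_, rfl⟩
  -- Everything is expressed through `z`, `τ` and `b - q`: stationarity yields `z * M ≤ τ ≤ z` and
  -- the exact value of `(b - q) * R`.
  obtain ⟨τ, hτ⟩ : ∃ τ, τ = q - z := ⟨_, rfl⟩
  have hτ0 : 0 ≤ τ := by linarith
  have hz6 : z ≤ 1 / 6 := by linarith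
  have hR1 : 1 / 2 + z ≤ R := by linarith
  have hτM : τ * (1 - q - q - z - z) = z * M := by rw [hτ]; linarith
  have hzM : z * M ≤ τ := by
    have := mul_nonneg hτ0 (show 0 ≤ 2 * q + 2 * z by linarith)
    linarith
  have hτz : τ ≤ z := by
    have := mul_le_mul_of_nonneg_left (show M ≤ 1 - q - q - z - z by linarith) hz.le
    exact le_of_mul_le_mul_right (by linarith) hS
  have hα : (b - q) * R = 3 * z ^ 2 + 2 * z * τ := by
    rw [hτ, hR]
    linear_combination -hap
  -- Again the leading-order maximizer: for small, nearly equal weights the gain is about `12 * z ^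
  -- 2 * ε - 6 * ε ^ 2`.
  obtain ⟨ε, hε⟩ : ∃ ε, ε = z ^ 2 := ⟨_, rfl⟩
  have hε0 : 0 ≤ ε := by rw [hε]; positivity
  have hεz : ε ≤ z := by rw [hε]; nlinarith
  refine ⟨b - ε, b - ε, q + 2 * ε, q + 2 * ε, z - ε, z - ε, by linarith, by linarith, by linarith,
    by linarith, by linarith, by linarith, by ring, ?_⟩
  have hid : weightC e₁ e₂ e₃ M (b - ε) (b - ε) (q + 2 * ε) (q + 2 * ε) (z - ε) (z - ε)
      + (q + 2 * ε) * (q + 2 * ε) * ((z - ε) + (z - ε))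
      - (z - ε) * (z - ε) * ((b - ε) + (b - ε)) - weightC e₁ e₂ e₃ M b b q q z z
      = 2 * z * (q ^ 2 - z * b) + ε * (2 * z ^ 2 + 8 * q * z + 4 * z * b - 2 * q ^ 2)
        - ε ^ 2 * (6 - 6 * q - 6 * z + M) + 2 * ε ^ 3 := by
    obtain rfl : e₁ = 1 - (b + b + q + q + z + z) := by linarith
    unfold weightC
    linear_combination 2 * ε * (hpw - hap)
  -- After `ε = z ^ 2`, the total change is `z` times this expression plus the nonnegative terms
  -- `h2`, `h3`, `h4` of `hfin`. Multiplying by `R` allows `b - q` to be eliminated through `hα`.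
  have hX : 0 ≤ 2 * q * τ + 6 * z ^ 3 + 12 * z ^ 4 - 2 * z * (b - q) * (1 - 2 * z) := by
    have hR0 : 0 < R := by linarith
    have hα' : b - q ≤ 6 * z ^ 2 + 4 * z * τ := by
      have := mul_nonneg (sub_nonneg.2 hqb) (show 0 ≤ R - 1 / 2 by linarith)
      linarith
    have h1 : -(2 + 4 * z) * τ ≤ (1 + 2 * z) * R - (1 - 2 * z) := by
      have h2 : 2 * z * (1 / 2 + z) ≤ 2 * z * R := by gcongr
      have h3 : 0 ≤ z * (1 - 4 * z) := mul_nonneg hz.le (by linarith)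
      have h4 : R = 1 - 2 * z - 2 * τ - (b - q) := by linarith
      linarith
    have h2 : 6 * z ^ 3 * (-(2 + 4 * z) * τ) ≤ 6 * z ^ 3 * ((1 + 2 * z) * R - (1 - 2 * z)) := by
      gcongr
    have h3 : 2 * z * τ * (1 / 2 + z) ≤ 2 * q * τ * R := by gcongr
    have h4 : 0 ≤ τ * z * (1 - 2 * z - 4 * z ^ 2 - 24 * z ^ 3) := by
      have h5 : z ^ 2 ≤ (1 / 6) ^ 2 := by gcongr
      have h6 : z ^ 3 ≤ (1 / 6) ^ 3 := by gcongr
      have : 0 ≤ 1 - 2 * z - 4 * z ^ 2 - 24 * z ^ 3 := by linarith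
      positivity
    have h5 : R * (2 * q * τ + 6 * z ^ 3 + 12 * z ^ 4 - 2 * z * (b - q) * (1 - 2 * z))
        = 2 * q * τ * R - 4 * z ^ 2 * (1 - 2 * z) * τ
          + 6 * z ^ 3 * ((1 + 2 * z) * R - (1 - 2 * z)) := by
      linear_combination (-2 * z * (1 - 2 * z)) * hα
    exact nonneg_of_mul_nonneg_right (a := R) (by rw [h5]; linarith) hR0
  have hfin : 0 ≤ 2 * z * (q ^ 2 - z * b) + ε * (2 * z ^ 2 + 8 * q * z + 4 * z * b - 2 * q ^ 2)
        - ε ^ 2 * (6 - 6 * q - 6 * z + M) + 2 * ε ^ 3 := by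
    have h1 := mul_nonneg hz.le hX
    have h2 : 0 ≤ z ^ 3 * (τ - z * M) := mul_nonneg (by positivity) (by linarith)
    have h3 : 0 ≤ z ^ 2 * τ * (7 * z - 2 * τ) := mul_nonneg (by positivity) (by linarith)
    have h4 : 0 ≤ 6 * z ^ 4 * τ + 2 * z ^ 6 := by positivity
    rw [hε]
    obtain rfl : q = z + τ := by linarith
    linarith
  linarith

/-! ### Elementary symmetric functions of the weights -/

/-- The `k`-th elementary symmetric function of the weights `x i`, `i ∈ S`. -/
noncomputable def elemSum (x : ℕ → ℝ) (S : Finset ℕ) (k : ℕ) : ℝ :=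
  ∑ e ∈ S.powersetCard k, ∏ i ∈ e, x i

theorem elemSum_zero (x : ℕ → ℝ) (S : Finset ℕ) : elemSum x S 0 = 1 := by
  simp [elemSum]

theorem elemSum_one (x : ℕ → ℝ) (S : Finset ℕ) : elemSum x S 1 = ∑ i ∈ S, x i := by
  simp [elemSum, Finset.powersetCard_one]

/-- This recursion splits off the few vertices whose weights move; the rest enters a weight
polynomial only through its symmetric functions of degree at most 3. -/
theorem elemSum_insert (x : ℕ → ℝ) {S : Finset ℕ} {i : ℕ} (hi : i ∉ S) (k : ℕ) :
    elemSum x (insert i S) (k + 1) = elemSum x S (k + 1) + x i * elemSum x S k := by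
  unfold elemSum
  rw [Finset.powersetCard_succ_insert hi, Finset.sum_union, Finset.sum_image, Finset.mul_sum]
  · congr 1
    refine Finset.sum_congr rfl fun e he => ?_
    exact Finset.prod_insert fun h => hi ((Finset.mem_powersetCard.1 he).1 h)
  · intro e he f hf h
    have he' : i ∉ e := fun h => hi ((Finset.mem_powersetCard.1 he).1 h)
    have hf' : i ∉ f := fun h => hi ((Finset.mem_powersetCard.1 hf).1 h)
    rw [← Finset.erase_insert he', h, Finset.erase_insert hf']
  · rw [Finset.disjoint_left]
    intro e he he'
    obtain ⟨f, -, rfl⟩ := Finset.mem_image.1 he'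
    exact hi ((Finset.mem_powersetCard.1 he).1 (Finset.mem_insert_self i f))

theorem elemSum_erase (x : ℕ → ℝ) {S : Finset ℕ} {i : ℕ} (hi : i ∈ S) (k : ℕ) :
    elemSum x S (k + 1) = elemSum x (S.erase i) (k + 1) + x i * elemSum x (S.erase i) k := by
  conv_lhs => rw [← Finset.insert_erase hi]
  exact elemSum_insert x (Finset.notMem_erase i S) k

theorem elemSum_Icc_succ (x : ℕ → ℝ) (n k : ℕ) :
    elemSum x (Finset.Icc 1 (n + 1)) (k + 1)
      = elemSum x (Finset.Icc 1 n) (k + 1) + x (n + 1) * elemSum x (Finset.Icc 1 n) k := by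
  rw [← elemSum_insert x (by simp)]
  congr 1
  ext i
  simp only [Finset.mem_Icc, Finset.mem_insert]
  omega

theorem elemSum_congr {x y : ℕ → ℝ} {S : Finset ℕ} (h : ∀ i ∈ S, x i = y i) (k : ℕ) :
    elemSum x S k = elemSum y S k :=
  Finset.sum_congr rfl fun _ he => Finset.prod_congr rfl fun i hi =>
    h i ((Finset.mem_powersetCard.1 he).1 hi)

theorem elemSum_comp_perm (x : ℕ → ℝ) (σ : Equiv.Perm ℕ) {S : Finset ℕ}
    (hS : S.map σ.toEmbedding = S) (k : ℕ) : elemSum (x ∘ σ) S k = elemSum x S k := by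
  unfold elemSum
  conv_rhs => rw [← hS, Finset.powersetCard_map, Finset.sum_map]
  refine Finset.sum_congr rfl fun e _ => ?_
  simp [Finset.mapEmbedding]

/-! ### Star triples and initial segments of the colex order -/

/-- The triples `{i, u + 1, u + 2}` with `s < i ≤ u`. -/
def starTriples (s u : ℕ) : Finset (Finset ℕ) :=
  (Finset.Icc (s + 1) u).image fun i => {i, u + 1, u + 2}

theorem eq_of_triple_eq {u i j : ℕ} (hi : i ≤ u)
    (h : ({i, u + 1, u + 2} : Finset ℕ) = {j, u + 1, u + 2}) : i = j := by
  have : i ∈ ({j, u + 1, u + 2} : Finset ℕ) := h ▸ Finset.mem_insert_self _ _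
  simp only [Finset.mem_insert, Finset.mem_singleton] at this
  omega

theorem mem_starTriples {s u i : ℕ} (hi : i ≤ u) :
    ({i, u + 1, u + 2} : Finset ℕ) ∈ starTriples s u ↔ s < i := by
  unfold starTriples
  rw [Finset.mem_image]
  constructor
  · rintro ⟨j, hj, h⟩
    rw [Finset.mem_Icc] at hj
    have := eq_of_triple_eq hj.2 h
    omega
  · exact fun h => ⟨i, Finset.mem_Icc.2 ⟨h, hi⟩, rfl⟩

theorem card_starTriples (s u : ℕ) : (starTriples s u).card = u - s := by
  unfold starTriples
  rw [Finset.card_image_of_injOn, Nat.card_Icc]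
  · omega
  · intro i hi j _ h
    exact eq_of_triple_eq (Finset.mem_Icc.1 hi).2 h

theorem card_triple {i j k : ℕ} (hij : i < j) (hjk : j < k) :
    ({i, j, k} : Finset ℕ).card = 3 :=
  Finset.card_eq_three.2 ⟨i, j, k, hij.ne, (hij.trans hjk).ne, hjk.ne, rfl⟩

theorem starTriples_subset (s u : ℕ) :
    starTriples s u ⊆ (Finset.Icc 1 (u + 2)).powersetCard 3 := by
  intro e he
  obtain ⟨i, hi, rfl⟩ := Finset.mem_image.1 he
  rw [Finset.mem_Icc] at hi
  rw [Finset.mem_powersetCard]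
  refine ⟨fun j hj => ?_, card_triple (by omega) (by omega)⟩
  simp only [Finset.mem_insert, Finset.mem_singleton] at hj
  rw [Finset.mem_Icc]
  omega

theorem prod_triple (x : ℕ → ℝ) {i j k : ℕ} (hij : i < j) (hjk : j < k) :
    ∏ v ∈ ({i, j, k} : Finset ℕ), x v = x i * x j * x k := by
  rw [Finset.prod_insert, Finset.prod_pair hjk.ne, mul_assoc]
  simp only [Finset.mem_insert, Finset.mem_singleton]
  omega

theorem sum_starTriples (x : ℕ → ℝ) (s u : ℕ) :
    ∑ e ∈ starTriples s u, ∏ i ∈ e, x i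
      = x (u + 1) * x (u + 2) * ∑ i ∈ Finset.Icc (s + 1) u, x i := by
  unfold starTriples
  rw [Finset.sum_image, Finset.mul_sum]
  · refine Finset.sum_congr rfl fun i hi => ?_
    rw [Finset.mem_Icc] at hi
    rw [prod_triple x (by omega) (by omega)]
    ring
  · intro i hi j _ h
    exact eq_of_triple_eq (Finset.mem_Icc.1 hi).2 h

theorem exists_triple_of_card {e : Finset ℕ} (he : e.card = 3) :
    ∃ i j k, i < j ∧ j < k ∧ e = {i, j, k} := by
  refine ⟨e.orderEmbOfFin he 0, e.orderEmbOfFin he 1, e.orderEmbOfFin he 2, by simp, by simp, ?_⟩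
  rw [← Finset.coe_inj, ← Finset.range_orderEmbOfFin e he]
  ext v
  simp only [Set.mem_range, Finset.coe_insert, Finset.coe_singleton, Set.mem_insert_iff,
    Set.mem_singleton_iff]
  constructor
  · rintro ⟨y, rfl⟩
    fin_cases y <;> simp
  · rintro (rfl | rfl | rfl) <;> exact ⟨_, rfl⟩

/-- Initial segments of the colex ordering with the same number of triples coincide. -/
theorem colexEdges_eq_sdiff_starTriples {u b m : ℕ} (hb : b ≤ u)
    (hm : m = (u + 1).choose 3 + u.choose 2 + b) :
    colexEdges 3 m = (Finset.Icc 1 (u + 2)).powersetCard 3 \ starTriples b u := by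
  set X := (Finset.Icc 1 (u + 2)).powersetCard 3 \ starTriples b u with hX
  have hcX : X.card = m := by
    rw [hX, Finset.card_sdiff_of_subset (starTriples_subset b u), card_starTriples,
      Finset.card_powersetCard, Nat.card_Icc, Nat.add_sub_cancel,
      Nat.choose_succ_succ' (u + 1) 2, Nat.choose_succ_succ' u 1, Nat.choose_one_right]
    have : (u + 1).choose (2 + 1) = (u + 1).choose 3 := rfl
    have : u.choose (1 + 1) = u.choose 2 := rfl
    omega
  have hdown : ∀ A ∈ X, ∀ B : Finset ℕ, B.card = 3 → (∀ i ∈ B, 0 < i) →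
      toColex B < toColex A → B ∈ X := by
    intro A hA B hB hpos hlt
    rw [hX, Finset.mem_sdiff, Finset.mem_powersetCard] at hA ⊢
    refine ⟨⟨fun i hi => Finset.mem_Icc.2 ⟨hpos i hi, ?_⟩, hB⟩, fun hBs => hA.2 ?_⟩
    · exact Finset.Colex.forall_le_mono hlt.le
        (fun j hj => (Finset.mem_Icc.1 (hA.1.1 hj)).2) i hi
    · obtain ⟨i, hi, rfl⟩ := Finset.mem_image.1 hBs
      rw [Finset.mem_Icc] at hi
      -- A triple of `[u + 2]` above `{i, u + 1, u + 2}` in colex must itself contain `u + 1` and `u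
      -- + 2`, and its third element exceeds `i`.
      obtain ⟨a, haA, haB, h⟩ := Finset.Colex.toColex_lt_toColex_iff_exists_forall_lt.1 hlt
      have ha := Finset.mem_Icc.1 (hA.1.1 haA)
      simp only [Finset.mem_insert, Finset.mem_singleton, not_or] at haB
      have h1 : u + 1 ∈ A := by
        by_contra hn
        have := h (u + 1) (by simp) hn
        omega
      have h2 : u + 2 ∈ A := by
        by_contra hn
        have := h (u + 2) (by simp) hn
        omega
      have hAe : {a, u + 1, u + 2} = A := by
        apply Finset.eq_of_subset_of_card_le
        · intro v hv
          simp only [Finset.mem_insert, Finset.mem_singleton] at hv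
          rcases hv with rfl | rfl | rfl <;> assumption
        · rw [hA.1.2, card_triple (by omega) (by omega)]
      rw [← hAe, mem_starTriples (by omega)]
      have h3 : i ∉ A := by
        rw [← hAe]
        simp only [Finset.mem_insert, Finset.mem_singleton]
        intro h'
        have h4 : i = a := by omega
        exact haB.1 h4.symm
      have := h i (by simp) h3
      omega
  have hposX : ∀ A ∈ X, A.card = 3 ∧ ∀ i ∈ A, 0 < i := by
    intro A hA
    have := Finset.mem_powersetCard.1 (Finset.mem_sdiff.1 hA).1
    exact ⟨this.2, fun i hi => (Finset.mem_Icc.1 (this.1 hi)).1⟩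
  have hposC : ∀ A ∈ colexEdges 3 m, A.card = 3 ∧ ∀ i ∈ A, 0 < i := by
    intro A hA
    have := Finset.mem_powersetCard.1 (Finset.mem_filter.1 hA).1
    exact ⟨this.2, fun i hi => (Finset.mem_Icc.1 (this.1 hi)).1⟩
  have hcC := card_colexEdges (r := 3) (by norm_num) m
  -- Two initial segments are comparable: an element of `X` outside `colexEdges 3 m` lies above all
  -- of `colexEdges 3 m`. Equal cardinality then forces equality.
  by_cases hsub : X ⊆ colexEdges 3 m
  · exact (Finset.eq_of_subset_of_card_le hsub (by rw [hcX, hcC])).symm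
  · obtain ⟨A, hAX, hAC⟩ := Finset.not_subset.1 hsub
    refine Finset.eq_of_subset_of_card_le (fun B hB => ?_) (by rw [hcX, hcC])
    rcases lt_trichotomy (toColex B) (toColex A) with h | h | h
    · exact hdown A hAX B (hposC B hB).1 (hposC B hB).2 h
    · have : B = A := by simpa using h
      exact absurd (this ▸ hB) hAC
    · exact absurd (mem_colexEdges_of_lt hB (hposX A hAX).1 (hposX A hAX).2 h) hAC

theorem verts_colexGraph {u b m : ℕ} (hb : b ≤ u) (hb0 : 0 < b)
    (hm : m = (u + 1).choose 3 + u.choose 2 + b) :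
    (colexGraph 3 m).verts = Finset.Icc 1 (u + 2) := by
  show (colexEdges 3 m).biUnion id = _
  rw [colexEdges_eq_sdiff_starTriples hb hm]
  ext v
  simp only [Finset.mem_biUnion, id]
  constructor
  · rintro ⟨e, he, hv⟩
    exact (Finset.mem_powersetCard.1 (Finset.mem_sdiff.1 he).1).1 hv
  · intro hv
    rw [Finset.mem_Icc] at hv
    have hmem : ∀ i j k, 1 ≤ i → i < j → j < k → k ≤ u + 2 → (j ≤ u ∨ i ≤ b) →
        ({i, j, k} : Finset ℕ) ∈ (Finset.Icc 1 (u + 2)).powersetCard 3 \ starTriples b u := by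
      intro i j k hi hij hjk hk h
      rw [Finset.mem_sdiff, Finset.mem_powersetCard]
      refine ⟨⟨fun v hv => ?_, card_triple hij hjk⟩, fun hs => ?_⟩
      · simp only [Finset.mem_insert, Finset.mem_singleton] at hv
        rw [Finset.mem_Icc]
        omega
      · obtain ⟨l, hl, he⟩ := Finset.mem_image.1 hs
        rw [Finset.mem_Icc] at hl
        have h1 : u + 1 ∈ ({i, j, k} : Finset ℕ) := he ▸ by simp
        have h2 : u + 2 ∈ ({i, j, k} : Finset ℕ) := he ▸ by simp
        have h3 : l ∈ ({i, j, k} : Finset ℕ) := he ▸ by simp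
        simp only [Finset.mem_insert, Finset.mem_singleton] at h1 h2 h3
        omega
    -- The vertices `1`, `u + 1`, `u + 2` are covered by `{1, u + 1, u + 2}`, an edge because `1 ≤
    -- b`.
    by_cases h : 2 ≤ v ∧ v ≤ u
    · exact ⟨{1, v, u + 2}, hmem 1 v (u + 2) le_rfl (by omega) (by omega) le_rfl (by omega),
        by simp⟩
    · refine ⟨{1, u + 1, u + 2}, hmem 1 (u + 1) (u + 2) le_rfl (by omega) (by omega) le_rfl
        (by omega), ?_⟩
      simp only [Finset.mem_insert, Finset.mem_singleton]
      omega

theorem sum_Icc_eq_add_sum (y : ℕ → ℝ) {b u : ℕ} (h : b < u) :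
    ∑ i ∈ Finset.Icc (b + 1) u, y i = y (b + 1) + ∑ i ∈ Finset.Icc (b + 2) u, y i := by
  rw [← Finset.insert_Icc_succ_left_eq_Icc (show b + 1 ≤ u by omega), Finset.sum_insert (by simp)]
  rfl

theorem notMem_starTriples {s u i j k : ℕ} (hij : i < j) (hj : j ≤ u) :
    ({i, j, k} : Finset ℕ) ∉ starTriples s u := by
  intro h
  obtain ⟨l, hl, h⟩ := Finset.mem_image.1 h
  rw [Finset.mem_Icc] at hl
  have h1 : u + 1 ∈ ({i, j, k} : Finset ℕ) := h ▸ by simp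
  have h2 : u + 2 ∈ ({i, j, k} : Finset ℕ) := h ▸ by simp
  simp only [Finset.mem_insert, Finset.mem_singleton] at h1 h2
  omega

theorem triple_mem_powersetCard {t i j k : ℕ} (hi : 1 ≤ i) (hij : i < j) (hjk : j < k)
    (hk : k ≤ t) : ({i, j, k} : Finset ℕ) ∈ (Finset.Icc 1 t).powersetCard 3 := by
  rw [Finset.mem_powersetCard]
  refine ⟨fun v hv => ?_, card_triple hij hjk⟩
  simp only [Finset.mem_insert, Finset.mem_singleton] at hv
  rw [Finset.mem_Icc]
  omega

/-! ### Comparison of Lagrangians for the three shapes of `X` -/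

namespace RGraph

theorem weight_le_lagrangian {r : ℕ} (G : RGraph r) (hG : G.verts.Nonempty) {x : ℕ → ℝ}
    (hx : G.IsLegal x) : G.weight x ≤ G.lagrangian :=
  (G.isGreatest_lagrangian hG).2 ⟨x, hx, rfl⟩

theorem weight_eq_elemSum_sub {G : RGraph 3} {t : ℕ} {K : Finset (Finset ℕ)}
    (hK : K ⊆ (Finset.Icc 1 t).powersetCard 3)
    (hE : G.edges = (Finset.Icc 1 t).powersetCard 3 \ K) (x : ℕ → ℝ) :
    G.weight x = elemSum x (Finset.Icc 1 t) 3 - ∑ e ∈ K, ∏ i ∈ e, x i := by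
  unfold weight elemSum
  rw [hE, ← Finset.sum_sdiff hK, add_sub_cancel_right]

/-- To bound the Lagrangian of `G` by that of a complete `3`-graph without some triples
`{i, u + 1, u + 2}`, only optimal weightings with positive weights have to be considered. -/
theorem lagrangian_le_of_forall_pos {G C : RGraph 3} {u b : ℕ}
    (hG : G.verts = Finset.Icc 1 (u + 2)) (hC : C.verts = Finset.Icc 1 (u + 2))
    (hCE : C.edges = (Finset.Icc 1 (u + 2)).powersetCard 3 \ starTriples b u)
    (h : ∀ x : ℕ → ℝ, (∀ i ∈ Finset.Icc 1 (u + 2), 0 < x i) →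
      ∑ i ∈ Finset.Icc 1 (u + 2), x i = 1 →
      (∀ y : ℕ → ℝ, (∀ i ∈ Finset.Icc 1 (u + 2), 0 ≤ y i) →
        ∑ i ∈ Finset.Icc 1 (u + 2), y i = 1 → G.weight y ≤ G.weight x) →
      ∃ y : ℕ → ℝ, (∀ i ∈ Finset.Icc 1 (u + 2), 0 ≤ y i) ∧
        ∑ i ∈ Finset.Icc 1 (u + 2), y i = 1 ∧ G.weight x ≤ C.weight y) :
    G.lagrangian ≤ C.lagrangian := by
  have hne : (Finset.Icc 1 (u + 2)).Nonempty := ⟨1, by simp⟩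
  obtain ⟨⟨x, ⟨hx0, hx1⟩, hx⟩, hmax⟩ := G.isGreatest_lagrangian (hG ▸ hne)
  rw [hG] at hx0 hx1
  suffices ∃ y : ℕ → ℝ, (∀ i ∈ Finset.Icc 1 (u + 2), 0 ≤ y i) ∧
      ∑ i ∈ Finset.Icc 1 (u + 2), y i = 1 ∧ G.weight x ≤ C.weight y by
    obtain ⟨y, hy0, hy1, hy⟩ := this
    rw [← hx]
    exact hy.trans (C.weight_le_lagrangian (hC ▸ hne) ⟨hC ▸ hy0, hC ▸ hy1⟩)
  by_cases hpos : ∀ i ∈ Finset.Icc 1 (u + 2), 0 < x i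
  · refine h x hpos hx1 fun y hy0 hy1 => ?_
    rw [hx]
    exact G.weight_le_lagrangian (hG ▸ hne) ⟨hG ▸ hy0, hG ▸ hy1⟩
  · push Not at hpos
    -- Swapping the zero weight to `u + 2` kills every triple that `C` lacks, so `C` attains the
    -- weight of the complete 3-graph at `x`, which is at least that of `G`.
    obtain ⟨k, hk, hxk⟩ := hpos
    have hxk0 : x k = 0 := le_antisymm hxk (hx0 k hk)
    have hu : u + 2 ∈ Finset.Icc 1 (u + 2) := by simp
    have hσm : ∀ i ∈ Finset.Icc 1 (u + 2), Equiv.swap k (u + 2) i ∈ Finset.Icc 1 (u + 2) := by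
      intro i hi
      rw [Equiv.swap_apply_def]
      split_ifs <;> assumption
    have hσ : (Finset.Icc 1 (u + 2)).map (Equiv.swap k (u + 2)).toEmbedding
        = Finset.Icc 1 (u + 2) := by
      refine Finset.eq_of_subset_of_card_le (fun i hi => ?_) (by rw [Finset.card_map])
      obtain ⟨j, hj, rfl⟩ := Finset.mem_map.1 hi
      exact hσm j hj
    refine ⟨x ∘ Equiv.swap k (u + 2), fun i hi => hx0 _ (hσm i hi), ?_, ?_⟩
    · rw [← elemSum_one, elemSum_comp_perm x _ hσ, elemSum_one, hx1]
    · rw [weight_eq_elemSum_sub (starTriples_subset b u) hCE, sum_starTriples,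
        elemSum_comp_perm x _ hσ]
      simp only [Function.comp_apply, Equiv.swap_apply_right, hxk0]
      rw [mul_zero, zero_mul, sub_zero]
      refine Finset.sum_le_sum_of_subset_of_nonneg (hG ▸ G.edges_subset) fun e he _ => ?_
      exact Finset.prod_nonneg fun i hi => hx0 i ((Finset.mem_powersetCard.1 he).1 hi)

/-- Adding the triple `{u + 1, u + 2, u + 4}` and deleting `{b + 1, u + 3, u + 4}` does not
decrease the Lagrangian. -/
theorem lagrangian_le_of_missing_triple {G C : RGraph 3} {u b : ℕ} (hb : b + 1 ≤ u)
    (hG : G.verts = Finset.Icc 1 (u + 4)) (hC : C.verts = Finset.Icc 1 (u + 4))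
    (hCE : C.edges = (Finset.Icc 1 (u + 4)).powersetCard 3 \ starTriples b (u + 2))
    (hGE : G.edges = (Finset.Icc 1 (u + 4)).powersetCard 3 \
      (starTriples (b + 1) (u + 2) ∪ {{u + 1, u + 2, u + 4}})) :
    G.lagrangian ≤ C.lagrangian := by
  refine lagrangian_le_of_forall_pos hG hC hCE fun x hx0 hx1 hmax => ?_
  -- The vertices whose weights stay fixed; those among them above `b + 1` carry the weight `M`.
  set W := (Finset.Icc 1 u).erase (b + 1) with hW
  have hmemW : ∀ i, i ∈ W ↔ i ≠ b + 1 ∧ 1 ≤ i ∧ i ≤ u := by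
    intro i
    simp only [hW, Finset.mem_erase, Finset.mem_Icc]
  have hbu : b + 1 ∈ Finset.Icc 1 u := Finset.mem_Icc.2 (by omega)
  have hMW : Finset.Icc (b + 2) u ⊆ W := by
    intro i hi
    rw [Finset.mem_Icc] at hi
    rw [hmemW]
    omega
  have hGw : ∀ y : ℕ → ℝ, G.weight y = weightA (elemSum y W 1) (elemSum y W 2) (elemSum y W 3)
      (∑ i ∈ Finset.Icc (b + 2) u, y i) (y (b + 1)) (y (u + 1)) (y (u + 2)) (y (u + 3)) (y (u + 4)) := by
    intro y
    have hX : {{u + 1, u + 2, u + 4}} ⊆ (Finset.Icc 1 (u + 4)).powersetCard 3 :=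
      Finset.singleton_subset_iff.2 (triple_mem_powersetCard (by omega) (by omega) (by omega) (by omega))
    have hdisj : Disjoint (starTriples (b + 1) (u + 2)) {{u + 1, u + 2, u + 4}} :=
      Finset.disjoint_singleton_right.2 (notMem_starTriples (by omega) (by omega))
    rw [weight_eq_elemSum_sub (Finset.union_subset (starTriples_subset _ _) hX) hGE,
      Finset.sum_union hdisj, Finset.sum_singleton, sum_starTriples,
      Finset.sum_Icc_succ_top (by omega), Finset.sum_Icc_succ_top (by omega),
      prod_triple y (by omega) (by omega)]
    simp only [elemSum_Icc_succ, elemSum_erase y hbu, elemSum_zero, ← hW]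
    unfold weightA
    ring
  have hCw : ∀ y : ℕ → ℝ, C.weight y = G.weight y + y (u + 1) * y (u + 2) * y (u + 4)
      - y (u + 3) * y (u + 4) * y (b + 1) := by
    intro y
    rw [hGw, weight_eq_elemSum_sub (starTriples_subset _ _) hCE, sum_starTriples,
      Finset.sum_Icc_succ_top (by omega), Finset.sum_Icc_succ_top (by omega),
      sum_Icc_eq_add_sum y (by omega)]
    simp only [elemSum_Icc_succ, elemSum_erase y hbu, elemSum_zero, ← hW]
    unfold weightA
    ring
  have hsum : ∀ y : ℕ → ℝ, ∑ i ∈ Finset.Icc 1 (u + 4), y i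
      = elemSum y W 1 + y (b + 1) + y (u + 1) + y (u + 2) + y (u + 3) + y (u + 4) := by
    intro y
    rw [← elemSum_one]
    simp only [elemSum_Icc_succ _ _ 0, elemSum_erase y hbu 0, elemSum_zero, ← hW]
    ring
  -- Any redistribution of the weight of the five distinguished vertices extends to a legal
  -- weighting, so optimality of `x` turns into the hypothesis `hopt` of the real inequality, and
  -- its witnesses turn back into a weighting.
  have hmod : ∀ c0 c1 c2 c3 c4 : ℝ, 0 ≤ c0 → 0 ≤ c1 → 0 ≤ c2 → 0 ≤ c3 → 0 ≤ c4 →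
      c0 + c1 + c2 + c3 + c4 = x (b + 1) + x (u + 1) + x (u + 2) + x (u + 3) + x (u + 4) →
      ∃ y : ℕ → ℝ, (∀ i ∈ Finset.Icc 1 (u + 4), 0 ≤ y i) ∧ ∑ i ∈ Finset.Icc 1 (u + 4), y i = 1 ∧
        G.weight y = weightA (elemSum x W 1) (elemSum x W 2) (elemSum x W 3)
          (∑ i ∈ Finset.Icc (b + 2) u, x i) c0 c1 c2 c3 c4 ∧
        y (b + 1) = c0 ∧ y (u + 1) = c1 ∧ y (u + 2) = c2 ∧ y (u + 3) = c3 ∧ y (u + 4) = c4 := by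
    intro c0 c1 c2 c3 c4 hc0 hc1 hc2 hc3 hc4 hc
    obtain ⟨y, hyW, h0, h1, h2, h3, h4⟩ : ∃ y : ℕ → ℝ, (∀ i ∈ W, y i = x i) ∧
        y (b + 1) = c0 ∧ y (u + 1) = c1 ∧ y (u + 2) = c2 ∧ y (u + 3) = c3 ∧ y (u + 4) = c4 := by
      refine ⟨fun i => if i = b + 1 then c0 else if i = u + 1 then c1 else if i = u + 2 then c2 else if i = u + 3 then c3 else if i = u + 4 then c4 else x i, fun i hi => ?_, ?_, ?_, ?_, ?_, ?_⟩
      · rw [hmemW] at hi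
        dsimp only
        rw [if_neg (by omega), if_neg (by omega), if_neg (by omega), if_neg (by omega), if_neg (by omega)]
      all_goals
        dsimp only
        split_ifs <;> first | rfl | (exfalso; omega)
    refine ⟨y, fun i hi => ?_, ?_, ?_, h0, h1, h2, h3, h4⟩
    · rw [Finset.mem_Icc] at hi
      by_cases hiW : i ∈ W
      · rw [hyW i hiW]
        exact (hx0 i (Finset.mem_Icc.2 hi)).le
      · rw [hmemW] at hiW
        obtain rfl | rfl | rfl | rfl | rfl : i = b + 1 ∨ i = u + 1 ∨ i = u + 2 ∨ i = u + 3 ∨ i = u + 4 := by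
          omega
        exacts [hc0.trans_eq h0.symm, hc1.trans_eq h1.symm, hc2.trans_eq h2.symm, hc3.trans_eq h3.symm, hc4.trans_eq h4.symm]
    · rw [hsum, elemSum_congr hyW, h0, h1, h2, h3, h4, ← hx1, hsum]
      linarith
    · rw [hGw, h0, h1, h2, h3, h4, elemSum_congr hyW, elemSum_congr hyW, elemSum_congr hyW,
        Finset.sum_congr rfl fun i hi => hyW i (hMW hi)]
  have hpos : ∀ i, 1 ≤ i → i ≤ u + 4 → 0 < x i := fun i h1 h2 => hx0 i (Finset.mem_Icc.2 ⟨h1, h2⟩)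
  have hWpos : ∀ i ∈ W, 0 ≤ x i := fun i hi =>
    (hpos i (by rw [hmemW] at hi; omega) (by rw [hmemW] at hi; omega)).le
  obtain ⟨c0, c1, c2, c3, hc0, hc1, hc2, hc3, hc, hle⟩ := exists_weightA_le
    (e₂ := elemSum x W 2) (e₃ := elemSum x W 3) (M := ∑ i ∈ Finset.Icc (b + 2) u, x i)
    (hpos (b + 1) (by omega) (by omega))
    (hpos (u + 1) (by omega) (by omega))
    (hpos (u + 2) (by omega) (by omega))
    (hpos (u + 3) (by omega) (by omega))
    (hpos (u + 4) (by omega) (by omega))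
    (Finset.sum_nonneg fun i hi => hWpos i (hMW hi))
    (by rw [elemSum_one]; exact Finset.sum_le_sum_of_subset_of_nonneg hMW fun i hi _ => hWpos i hi)
    ((hsum x).symm.trans hx1)
    (fun c0 c1 c2 c3 c4 hc0 hc1 hc2 hc3 hc4 hc => by
      obtain ⟨y, hy0, hy1, hy, -⟩ := hmod c0 c1 c2 c3 c4 hc0 hc1 hc2 hc3 hc4 hc
      rw [← hy, ← hGw]
      exact hmax y hy0 hy1)
  obtain ⟨y, hy0, hy1, hy, h0, h1, h2, h3, h4⟩ := hmod c0 c1 c2 c3 (x (u + 4)) hc0 hc1 hc2 hc3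
    (hpos (u + 4) (by omega) le_rfl).le (by linarith)
  refine ⟨y, hy0, hy1, ?_⟩
  rw [hCw, hy, h0, h1, h2, h3, h4, hGw]
  linarith

set_option maxHeartbeats 800000 in
/-- Adding the triples `{u + 1, u + 3, u + 5}`, `{u + 2, u + 3, u + 5}` and deleting
`{b + 1, u + 4, u + 5}`, `{b + 2, u + 4, u + 5}` does not decrease the Lagrangian. -/
theorem lagrangian_le_of_missing_path {G C : RGraph 3} {u b : ℕ} (hb : b + 2 ≤ u)
    (hG : G.verts = Finset.Icc 1 (u + 5)) (hC : C.verts = Finset.Icc 1 (u + 5))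
    (hCE : C.edges = (Finset.Icc 1 (u + 5)).powersetCard 3 \ starTriples b (u + 3))
    (hGE : G.edges = (Finset.Icc 1 (u + 5)).powersetCard 3 \
      (starTriples (b + 2) (u + 3) ∪ {{u + 1, u + 3, u + 5}, {u + 2, u + 3, u + 5}})) :
    G.lagrangian ≤ C.lagrangian := by
  refine lagrangian_le_of_forall_pos hG hC hCE fun x hx0 hx1 hmax => ?_
  -- Now two stars are exchanged, so both `b + 1` and `b + 2` are distinguished, together with the
  -- last five vertices.
  set W := ((Finset.Icc 1 u).erase (b + 1)).erase (b + 2) with hW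
  have hmemW : ∀ i, i ∈ W ↔ i ≠ b + 1 ∧ i ≠ b + 2 ∧ 1 ≤ i ∧ i ≤ u := by
    intro i
    simp only [hW, Finset.mem_erase, Finset.mem_Icc]
    tauto
  have hbu : b + 1 ∈ Finset.Icc 1 u := Finset.mem_Icc.2 (by omega)
  have hbu' : b + 2 ∈ (Finset.Icc 1 u).erase (b + 1) := by
    rw [Finset.mem_erase, Finset.mem_Icc]
    omega
  have hMW : Finset.Icc (b + 3) u ⊆ W := by
    intro i hi
    rw [Finset.mem_Icc] at hi
    rw [hmemW]
    omega
  have hGw : ∀ y : ℕ → ℝ, G.weight y = weightB (elemSum y W 1) (elemSum y W 2) (elemSum y W 3)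
      (∑ i ∈ Finset.Icc (b + 3) u, y i) (y (b + 1)) (y (b + 2)) (y (u + 1)) (y (u + 2)) (y (u + 3)) (y (u + 4)) (y (u + 5)) := by
    intro y
    have hX : {{u + 1, u + 3, u + 5}, {u + 2, u + 3, u + 5}} ⊆ (Finset.Icc 1 (u + 5)).powersetCard 3 :=
      Finset.insert_subset (triple_mem_powersetCard (by omega) (by omega) (by omega) (by omega))
        (Finset.singleton_subset_iff.2 (triple_mem_powersetCard (by omega) (by omega) (by omega) (by omega)))
    have hdisj : Disjoint (starTriples (b + 2) (u + 3)) {{u + 1, u + 3, u + 5}, {u + 2, u + 3, u + 5}} :=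
      Finset.disjoint_insert_right.2 ⟨notMem_starTriples (by omega) (by omega),
        Finset.disjoint_singleton_right.2 (notMem_starTriples (by omega) (by omega))⟩
    have hne : ({u + 1, u + 3, u + 5} : Finset ℕ) ≠ {u + 2, u + 3, u + 5} := by
      intro h
      have : u + 1 ∈ ({u + 2, u + 3, u + 5} : Finset ℕ) := h ▸ by simp
      simp at this
    rw [weight_eq_elemSum_sub (Finset.union_subset (starTriples_subset _ _) hX) hGE,
      Finset.sum_union hdisj, Finset.sum_pair hne, sum_starTriples,
      Finset.sum_Icc_succ_top (by omega), Finset.sum_Icc_succ_top (by omega), Finset.sum_Icc_succ_top (by omega),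
      prod_triple y (by omega) (by omega), prod_triple y (by omega) (by omega)]
    simp only [elemSum_Icc_succ, elemSum_erase y hbu, elemSum_erase y hbu', elemSum_zero, ← hW]
    unfold weightB
    ring
  have hCw : ∀ y : ℕ → ℝ, C.weight y = G.weight y + (y (u + 1) + y (u + 2)) * y (u + 3) * y (u + 5)
      - y (u + 4) * y (u + 5) * (y (b + 1) + y (b + 2)) := by
    intro y
    rw [hGw, weight_eq_elemSum_sub (starTriples_subset _ _) hCE, sum_starTriples,
      Finset.sum_Icc_succ_top (by omega), Finset.sum_Icc_succ_top (by omega), Finset.sum_Icc_succ_top (by omega),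
      sum_Icc_eq_add_sum y (by omega), sum_Icc_eq_add_sum y (by omega)]
    simp only [elemSum_Icc_succ, elemSum_erase y hbu, elemSum_erase y hbu', elemSum_zero, ← hW]
    unfold weightB
    ring
  have hsum : ∀ y : ℕ → ℝ, ∑ i ∈ Finset.Icc 1 (u + 5), y i
      = elemSum y W 1 + y (b + 1) + y (b + 2) + y (u + 1) + y (u + 2) + y (u + 3) + y (u + 4) + y (u + 5) := by
    intro y
    rw [← elemSum_one]
    simp only [elemSum_Icc_succ _ _ 0, elemSum_erase y hbu 0, elemSum_erase y hbu' 0, elemSum_zero, ← hW]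
    ring
  have hmod : ∀ c0 c1 c2 c3 c4 c5 c6 : ℝ, 0 ≤ c0 → 0 ≤ c1 → 0 ≤ c2 → 0 ≤ c3 → 0 ≤ c4 → 0 ≤ c5 → 0 ≤ c6 →
      c0 + c1 + c2 + c3 + c4 + c5 + c6 = x (b + 1) + x (b + 2) + x (u + 1) + x (u + 2) + x (u + 3) + x (u + 4) + x (u + 5) →
      ∃ y : ℕ → ℝ, (∀ i ∈ Finset.Icc 1 (u + 5), 0 ≤ y i) ∧ ∑ i ∈ Finset.Icc 1 (u + 5), y i = 1 ∧
        G.weight y = weightB (elemSum x W 1) (elemSum x W 2) (elemSum x W 3)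
          (∑ i ∈ Finset.Icc (b + 3) u, x i) c0 c1 c2 c3 c4 c5 c6 ∧
        y (b + 1) = c0 ∧ y (b + 2) = c1 ∧ y (u + 1) = c2 ∧ y (u + 2) = c3 ∧ y (u + 3) = c4 ∧ y (u + 4) = c5 ∧ y (u + 5) = c6 := by
    intro c0 c1 c2 c3 c4 c5 c6 hc0 hc1 hc2 hc3 hc4 hc5 hc6 hc
    obtain ⟨y, hyW, h0, h1, h2, h3, h4, h5, h6⟩ : ∃ y : ℕ → ℝ, (∀ i ∈ W, y i = x i) ∧
        y (b + 1) = c0 ∧ y (b + 2) = c1 ∧ y (u + 1) = c2 ∧ y (u + 2) = c3 ∧ y (u + 3) = c4 ∧ y (u + 4) = c5 ∧ y (u + 5) = c6 := by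
      refine ⟨fun i => if i = b + 1 then c0 else if i = b + 2 then c1 else if i = u + 1 then c2 else if i = u + 2 then c3 else if i = u + 3 then c4 else if i = u + 4 then c5 else if i = u + 5 then c6 else x i, fun i hi => ?_, ?_, ?_, ?_, ?_, ?_, ?_, ?_⟩
      · rw [hmemW] at hi
        dsimp only
        rw [if_neg (by omega), if_neg (by omega), if_neg (by omega), if_neg (by omega), if_neg (by omega), if_neg (by omega), if_neg (by omega)]
      all_goals
        dsimp only
        split_ifs <;> first | rfl | (exfalso; omega)
    refine ⟨y, fun i hi => ?_, ?_, ?_, h0, h1, h2, h3, h4, h5, h6⟩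
    · rw [Finset.mem_Icc] at hi
      by_cases hiW : i ∈ W
      · rw [hyW i hiW]
        exact (hx0 i (Finset.mem_Icc.2 hi)).le
      · rw [hmemW] at hiW
        obtain rfl | rfl | rfl | rfl | rfl | rfl | rfl : i = b + 1 ∨ i = b + 2 ∨ i = u + 1 ∨ i = u + 2 ∨ i = u + 3 ∨ i = u + 4 ∨ i = u + 5 := by
          omega
        exacts [hc0.trans_eq h0.symm, hc1.trans_eq h1.symm, hc2.trans_eq h2.symm, hc3.trans_eq h3.symm, hc4.trans_eq h4.symm, hc5.trans_eq h5.symm, hc6.trans_eq h6.symm]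
    · rw [hsum, elemSum_congr hyW, h0, h1, h2, h3, h4, h5, h6, ← hx1, hsum]
      linarith
    · rw [hGw, h0, h1, h2, h3, h4, h5, h6, elemSum_congr hyW, elemSum_congr hyW, elemSum_congr hyW,
        Finset.sum_congr rfl fun i hi => hyW i (hMW hi)]
  have hpos : ∀ i, 1 ≤ i → i ≤ u + 5 → 0 < x i := fun i h1 h2 => hx0 i (Finset.mem_Icc.2 ⟨h1, h2⟩)
  have hWpos : ∀ i ∈ W, 0 ≤ x i := fun i hi =>
    (hpos i (by rw [hmemW] at hi; omega) (by rw [hmemW] at hi; omega)).le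
  obtain ⟨c0, c1, c2, c3, c4, c5, hc0, hc1, hc2, hc3, hc4, hc5, hc, hle⟩ := exists_weightB_le
    (e₂ := elemSum x W 2) (e₃ := elemSum x W 3) (M := ∑ i ∈ Finset.Icc (b + 3) u, x i)
    (hpos (b + 1) (by omega) (by omega))
    (hpos (b + 2) (by omega) (by omega))
    (hpos (u + 1) (by omega) (by omega))
    (hpos (u + 2) (by omega) (by omega))
    (hpos (u + 3) (by omega) (by omega))
    (hpos (u + 4) (by omega) (by omega))
    (hpos (u + 5) (by omega) (by omega))
    (Finset.sum_nonneg fun i hi => hWpos i (hMW hi))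
    (by rw [elemSum_one]; exact Finset.sum_le_sum_of_subset_of_nonneg hMW fun i hi _ => hWpos i hi)
    ((hsum x).symm.trans hx1)
    (fun c0 c1 c2 c3 c4 c5 c6 hc0 hc1 hc2 hc3 hc4 hc5 hc6 hc => by
      obtain ⟨y, hy0, hy1, hy, -⟩ := hmod c0 c1 c2 c3 c4 c5 c6 hc0 hc1 hc2 hc3 hc4 hc5 hc6 hc
      rw [← hy, ← hGw]
      exact hmax y hy0 hy1)
  obtain ⟨y, hy0, hy1, hy, h0, h1, h2, h3, h4, h5, h6⟩ := hmod c0 c1 c2 c3 c4 c5 (x (u + 5)) hc0 hc1 hc2 hc3 hc4 hc5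
    (hpos (u + 5) (by omega) le_rfl).le (by linarith)
  refine ⟨y, hy0, hy1, ?_⟩
  rw [hCw, hy, h0, h1, h2, h3, h4, h5, h6, hGw]
  linarith

/-- Adding the triples `{u + 1, u + 2, u + 4}`, `{u + 1, u + 2, u + 3}` and deleting
`{b + 1, u + 3, u + 4}`, `{b + 2, u + 3, u + 4}` does not decrease the Lagrangian. -/
theorem lagrangian_le_of_missing_pair {G C : RGraph 3} {u b : ℕ} (hb : b + 2 ≤ u)
    (hG : G.verts = Finset.Icc 1 (u + 4)) (hC : C.verts = Finset.Icc 1 (u + 4))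
    (hCE : C.edges = (Finset.Icc 1 (u + 4)).powersetCard 3 \ starTriples b (u + 2))
    (hGE : G.edges = (Finset.Icc 1 (u + 4)).powersetCard 3 \
      (starTriples (b + 2) (u + 2) ∪ {{u + 1, u + 2, u + 4}, {u + 1, u + 2, u + 3}})) :
    G.lagrangian ≤ C.lagrangian := by
  refine lagrangian_le_of_forall_pos hG hC hCE fun x hx0 hx1 hmax => ?_
  -- The distinguished vertices are `b + 1`, `b + 2` and the last four.
  set W := ((Finset.Icc 1 u).erase (b + 1)).erase (b + 2) with hW
  have hmemW : ∀ i, i ∈ W ↔ i ≠ b + 1 ∧ i ≠ b + 2 ∧ 1 ≤ i ∧ i ≤ u := by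
    intro i
    simp only [hW, Finset.mem_erase, Finset.mem_Icc]
    tauto
  have hbu : b + 1 ∈ Finset.Icc 1 u := Finset.mem_Icc.2 (by omega)
  have hbu' : b + 2 ∈ (Finset.Icc 1 u).erase (b + 1) := by
    rw [Finset.mem_erase, Finset.mem_Icc]
    omega
  have hMW : Finset.Icc (b + 3) u ⊆ W := by
    intro i hi
    rw [Finset.mem_Icc] at hi
    rw [hmemW]
    omega
  have hGw : ∀ y : ℕ → ℝ, G.weight y = weightC (elemSum y W 1) (elemSum y W 2) (elemSum y W 3)
      (∑ i ∈ Finset.Icc (b + 3) u, y i) (y (b + 1)) (y (b + 2)) (y (u + 1)) (y (u + 2)) (y (u + 3)) (y (u + 4)) := by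
    intro y
    have hX : {{u + 1, u + 2, u + 4}, {u + 1, u + 2, u + 3}} ⊆ (Finset.Icc 1 (u + 4)).powersetCard 3 :=
      Finset.insert_subset (triple_mem_powersetCard (by omega) (by omega) (by omega) (by omega))
        (Finset.singleton_subset_iff.2 (triple_mem_powersetCard (by omega) (by omega) (by omega) (by omega)))
    have hdisj : Disjoint (starTriples (b + 2) (u + 2)) {{u + 1, u + 2, u + 4}, {u + 1, u + 2, u + 3}} :=
      Finset.disjoint_insert_right.2 ⟨notMem_starTriples (by omega) (by omega),
        Finset.disjoint_singleton_right.2 (notMem_starTriples (by omega) (by omega))⟩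
    have hne : ({u + 1, u + 2, u + 4} : Finset ℕ) ≠ {u + 1, u + 2, u + 3} := by
      intro h
      have : u + 4 ∈ ({u + 1, u + 2, u + 3} : Finset ℕ) := h ▸ by simp
      simp at this
    rw [weight_eq_elemSum_sub (Finset.union_subset (starTriples_subset _ _) hX) hGE,
      Finset.sum_union hdisj, Finset.sum_pair hne, sum_starTriples,
      Finset.sum_Icc_succ_top (by omega), Finset.sum_Icc_succ_top (by omega),
      prod_triple y (by omega) (by omega), prod_triple y (by omega) (by omega)]
    simp only [elemSum_Icc_succ, elemSum_erase y hbu, elemSum_erase y hbu', elemSum_zero, ← hW]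
    unfold weightC
    ring
  have hCw : ∀ y : ℕ → ℝ, C.weight y = G.weight y + y (u + 1) * y (u + 2) * (y (u + 3) + y (u + 4))
      - y (u + 3) * y (u + 4) * (y (b + 1) + y (b + 2)) := by
    intro y
    rw [hGw, weight_eq_elemSum_sub (starTriples_subset _ _) hCE, sum_starTriples,
      Finset.sum_Icc_succ_top (by omega), Finset.sum_Icc_succ_top (by omega),
      sum_Icc_eq_add_sum y (by omega), sum_Icc_eq_add_sum y (by omega)]
    simp only [elemSum_Icc_succ, elemSum_erase y hbu, elemSum_erase y hbu', elemSum_zero, ← hW]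
    unfold weightC
    ring
  have hsum : ∀ y : ℕ → ℝ, ∑ i ∈ Finset.Icc 1 (u + 4), y i
      = elemSum y W 1 + y (b + 1) + y (b + 2) + y (u + 1) + y (u + 2) + y (u + 3) + y (u + 4) := by
    intro y
    rw [← elemSum_one]
    simp only [elemSum_Icc_succ _ _ 0, elemSum_erase y hbu 0, elemSum_erase y hbu' 0, elemSum_zero, ← hW]
    ring
  have hmod : ∀ c0 c1 c2 c3 c4 c5 : ℝ, 0 ≤ c0 → 0 ≤ c1 → 0 ≤ c2 → 0 ≤ c3 → 0 ≤ c4 → 0 ≤ c5 →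
      c0 + c1 + c2 + c3 + c4 + c5 = x (b + 1) + x (b + 2) + x (u + 1) + x (u + 2) + x (u + 3) + x (u + 4) →
      ∃ y : ℕ → ℝ, (∀ i ∈ Finset.Icc 1 (u + 4), 0 ≤ y i) ∧ ∑ i ∈ Finset.Icc 1 (u + 4), y i = 1 ∧
        G.weight y = weightC (elemSum x W 1) (elemSum x W 2) (elemSum x W 3)
          (∑ i ∈ Finset.Icc (b + 3) u, x i) c0 c1 c2 c3 c4 c5 ∧
        y (b + 1) = c0 ∧ y (b + 2) = c1 ∧ y (u + 1) = c2 ∧ y (u + 2) = c3 ∧ y (u + 3) = c4 ∧ y (u + 4) = c5 := by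
    intro c0 c1 c2 c3 c4 c5 hc0 hc1 hc2 hc3 hc4 hc5 hc
    obtain ⟨y, hyW, h0, h1, h2, h3, h4, h5⟩ : ∃ y : ℕ → ℝ, (∀ i ∈ W, y i = x i) ∧
        y (b + 1) = c0 ∧ y (b + 2) = c1 ∧ y (u + 1) = c2 ∧ y (u + 2) = c3 ∧ y (u + 3) = c4 ∧ y (u + 4) = c5 := by
      refine ⟨fun i => if i = b + 1 then c0 else if i = b + 2 then c1 else if i = u + 1 then c2 else if i = u + 2 then c3 else if i = u + 3 then c4 else if i = u + 4 then c5 else x i, fun i hi => ?_, ?_, ?_, ?_, ?_, ?_, ?_⟩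
      · rw [hmemW] at hi
        dsimp only
        rw [if_neg (by omega), if_neg (by omega), if_neg (by omega), if_neg (by omega), if_neg (by omega), if_neg (by omega)]
      all_goals
        dsimp only
        split_ifs <;> first | rfl | (exfalso; omega)
    refine ⟨y, fun i hi => ?_, ?_, ?_, h0, h1, h2, h3, h4, h5⟩
    · rw [Finset.mem_Icc] at hi
      by_cases hiW : i ∈ W
      · rw [hyW i hiW]
        exact (hx0 i (Finset.mem_Icc.2 hi)).le
      · rw [hmemW] at hiW
        obtain rfl | rfl | rfl | rfl | rfl | rfl : i = b + 1 ∨ i = b + 2 ∨ i = u + 1 ∨ i = u + 2 ∨ i = u + 3 ∨ i = u + 4 := by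
          omega
        exacts [hc0.trans_eq h0.symm, hc1.trans_eq h1.symm, hc2.trans_eq h2.symm, hc3.trans_eq h3.symm, hc4.trans_eq h4.symm, hc5.trans_eq h5.symm]
    · rw [hsum, elemSum_congr hyW, h0, h1, h2, h3, h4, h5, ← hx1, hsum]
      linarith
    · rw [hGw, h0, h1, h2, h3, h4, h5, elemSum_congr hyW, elemSum_congr hyW, elemSum_congr hyW,
        Finset.sum_congr rfl fun i hi => hyW i (hMW hi)]
  have hpos : ∀ i, 1 ≤ i → i ≤ u + 4 → 0 < x i := fun i h1 h2 => hx0 i (Finset.mem_Icc.2 ⟨h1, h2⟩)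
  have hWpos : ∀ i ∈ W, 0 ≤ x i := fun i hi =>
    (hpos i (by rw [hmemW] at hi; omega) (by rw [hmemW] at hi; omega)).le
  obtain ⟨c0, c1, c2, c3, c4, c5, hc0, hc1, hc2, hc3, hc4, hc5, hc, hle⟩ := exists_weightC_le
    (e₂ := elemSum x W 2) (e₃ := elemSum x W 3) (M := ∑ i ∈ Finset.Icc (b + 3) u, x i)
    (hpos (b + 1) (by omega) (by omega))
    (hpos (b + 2) (by omega) (by omega))
    (hpos (u + 1) (by omega) (by omega))
    (hpos (u + 2) (by omega) (by omega))
    (hpos (u + 3) (by omega) (by omega))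
    (hpos (u + 4) (by omega) (by omega))
    (Finset.sum_nonneg fun i hi => hWpos i (hMW hi))
    (by rw [elemSum_one]; exact Finset.sum_le_sum_of_subset_of_nonneg hMW fun i hi _ => hWpos i hi)
    ((hsum x).symm.trans hx1)
    (fun c0 c1 c2 c3 c4 c5 hc0 hc1 hc2 hc3 hc4 hc5 hc => by
      obtain ⟨y, hy0, hy1, hy, -⟩ := hmod c0 c1 c2 c3 c4 c5 hc0 hc1 hc2 hc3 hc4 hc5 hc
      rw [← hy, ← hGw]
      exact hmax y hy0 hy1)
  obtain ⟨y, hy0, hy1, hy, h0, h1, h2, h3, h4, h5⟩ := hmod c0 c1 c2 c3 c4 c5 hc0 hc1 hc2 hc3 hc4 hc5 hc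
  refine ⟨y, hy0, hy1, ?_⟩
  rw [hCw, hy, h0, h1, h2, h3, h4, h5, hGw]
  linarith

end RGraph

/-! ### Non-edges of a left-compressed 3-graph -/

/-- A down-closed subset of `[u]` is an initial segment; applied to the neighbourhood of the pair `u
+ 1`, `u + 2`, it shows that this neighbourhood is determined by its size. -/
theorem filter_Icc_eq_Icc_card {u : ℕ} {p : ℕ → Prop} [DecidablePred p]
    (h : ∀ i j, 1 ≤ i → i ≤ j → j ≤ u → p j → p i) :
    (Finset.Icc 1 u).filter p = Finset.Icc 1 ((Finset.Icc 1 u).filter p).card := by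
  set Q := (Finset.Icc 1 u).filter p with hQ
  ext i
  rw [Finset.mem_Icc]
  constructor
  · intro hi
    have hi' := hi
    rw [hQ, Finset.mem_filter, Finset.mem_Icc] at hi'
    have : Finset.Icc 1 i ⊆ Q := by
      intro k hk
      rw [Finset.mem_Icc] at hk
      rw [hQ, Finset.mem_filter, Finset.mem_Icc]
      exact ⟨by omega, h k i hk.1 hk.2 hi'.1.2 hi'.2⟩
    have := Finset.card_le_card this
    rw [Nat.card_Icc] at this
    omega
  · rintro ⟨h1, h2⟩
    by_contra hi
    have : Q ⊆ Finset.Icc 1 (i - 1) := by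
      intro k hk
      have hk' := hk
      rw [hQ, Finset.mem_filter, Finset.mem_Icc] at hk'
      rw [Finset.mem_Icc]
      by_contra hlt
      refine hi ?_
      rw [hQ, Finset.mem_filter, Finset.mem_Icc]
      exact ⟨by omega, h i k h1 (by omega) hk'.1.2 hk'.2⟩
    have := Finset.card_le_card this
    rw [Nat.card_Icc] at this
    omega

namespace RGraph

theorem eq_of_verts_of_edges {r : ℕ} {G H : RGraph r} (hV : G.verts = H.verts)
    (hE : G.edges = H.edges) : G = H := by
  cases G
  cases H
  cases hV
  cases hE
  rfl

theorem LeftCompressed.triple_mem {G : RGraph 3} (hG : G.LeftCompressed) {t : ℕ}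
    (hV : G.verts = Finset.Icc 1 t) {i₁ i₂ i₃ j₁ j₂ j₃ : ℕ} (h0 : 1 ≤ i₁) (hi₁ : i₁ < i₂)
    (hi₂ : i₂ < i₃) (ht : i₃ ≤ t) (hj₁ : j₁ < j₂) (hj₂ : j₂ < j₃) (h₁ : i₁ ≤ j₁) (h₂ : i₂ ≤ j₂)
    (h₃ : i₃ ≤ j₃) (h : {j₁, j₂, j₃} ∈ G.edges) : {i₁, i₂, i₃} ∈ G.edges := by
  have himg : ∀ a b c : ℕ, Finset.univ.image ![a, b, c] = {a, b, c} := by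
    intro a b c
    ext v
    simp [Fin.exists_fin_succ, eq_comm]
  have hmono : ∀ a b c : ℕ, a < b → b < c → StrictMono ![a, b, c] := by
    intro a b c hab hbc
    rw [Fin.strictMono_iff_lt_succ]
    intro k
    fin_cases k
    · exact hab
    · exact hbc
  rw [← himg] at h ⊢
  refine hG _ _ (hmono _ _ _ hi₁ hi₂) (hmono _ _ _ hj₁ hj₂) (fun p => ?_) (fun p => ?_) h
  · rw [hV, Finset.mem_Icc]
    fin_cases p <;> simp <;> omega
  · fin_cases p
    · exact h₁
    · exact h₂
    · exact h₃

theorem card_pairNbhd {G : RGraph 3} {u : ℕ} (hV : G.verts = Finset.Icc 1 (u + 2)) :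
    (G.pairNbhd (u + 1) (u + 2)).card
      = ((Finset.Icc 1 u).filter fun i => ({i, u + 1, u + 2} : Finset ℕ) ∈ G.edges).card := by
  rw [← Finset.card_image_of_injective ((Finset.Icc 1 u).filter fun i =>
    ({i, u + 1, u + 2} : Finset ℕ) ∈ G.edges) Finset.singleton_injective]
  congr 1
  ext B
  unfold pairNbhd
  rw [Finset.mem_filter, Finset.mem_powerset, Finset.mem_image, hV]
  constructor
  · rintro ⟨hB, hc, hE⟩
    obtain ⟨i, rfl⟩ := Finset.card_eq_one.1 (show B.card = 1 by omega)
    have hi := Finset.mem_Icc.1 (Finset.singleton_subset_iff.1 hB)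
    have hE' : ({i, u + 1, u + 2} : Finset ℕ) ∈ G.edges := hE
    refine ⟨i, Finset.mem_filter.2 ⟨Finset.mem_Icc.2 ⟨hi.1, ?_⟩, hE'⟩, rfl⟩
    by_contra hlt
    have h3 := (Finset.mem_powersetCard.1 (G.edges_subset hE')).2
    have hsub : ({i, u + 1, u + 2} : Finset ℕ) ⊆ {u + 1, u + 2} := by
      intro v hv
      simp only [Finset.mem_insert, Finset.mem_singleton] at hv ⊢
      omega
    have := (Finset.card_le_card hsub).trans Finset.card_le_two
    omega
  · rintro ⟨i, hi, rfl⟩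
    rw [Finset.mem_filter, Finset.mem_Icc] at hi
    refine ⟨Finset.singleton_subset_iff.2 (Finset.mem_Icc.2 (by omega)), rfl, hi.2⟩

/-- A left-compressed `3`-graph on `[u + 2]` with `u - b` missing triples misses the triples
`{i, u + 1, u + 2}` with `i` larger than `|E_{(u + 1)(u + 2)}|`, and few others. -/
theorem LeftCompressed.exists_edges_eq {G : RGraph 3} (hG : G.LeftCompressed) {u b : ℕ}
    (hb : b ≤ u) (hV : G.verts = Finset.Icc 1 (u + 2))
    (hE : G.edges.card = (u + 1).choose 3 + u.choose 2 + b) :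
    ∃ X : Finset (Finset ℕ), (G.pairNbhd (u + 1) (u + 2)).card = b + X.card ∧
      G.edges = (Finset.Icc 1 (u + 2)).powersetCard 3 \
        (starTriples (G.pairNbhd (u + 1) (u + 2)).card u ∪ X) ∧
      (∀ e ∈ X, ∃ i j k, 1 ≤ i ∧ i < j ∧ j < k ∧ j ≤ u ∧ k ≤ u + 2 ∧ e = {i, j, k}) ∧
      (∀ i j k, 1 ≤ i → i < j → j < k → j ≤ u → k ≤ u + 2 →
        {i, j, k} ∉ G.edges → {i, j, k} ∈ X) ∧
      ∀ i, 1 ≤ i → i ≤ u → {i, u + 1, u + 2} ∉ G.edges →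
        (G.pairNbhd (u + 1) (u + 2)).card < i := by
  set s := (G.pairNbhd (u + 1) (u + 2)).card with hs
  have hsub : G.edges ⊆ (Finset.Icc 1 (u + 2)).powersetCard 3 := hV ▸ G.edges_subset
  have hQ := filter_Icc_eq_Icc_card (u := u)
    (p := fun i => ({i, u + 1, u + 2} : Finset ℕ) ∈ G.edges)
    fun i j h1 hij hj h => hG.triple_mem hV h1 (by omega) (by omega) le_rfl (by omega) (by omega)
      hij le_rfl le_rfl h
  rw [← card_pairNbhd hV, ← hs] at hQ
  have hstar : ∀ i, 1 ≤ i → i ≤ u → (({i, u + 1, u + 2} : Finset ℕ) ∈ G.edges ↔ i ≤ s) := by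
    intro i h1 h2
    have := Finset.ext_iff.1 hQ i
    simp only [Finset.mem_filter, Finset.mem_Icc, h1, h2, true_and, and_true] at this
    exact this
  have hsu : s ≤ u := by
    rw [hs, card_pairNbhd hV]
    exact (Finset.card_filter_le _ _).trans (by simp)
  set K := (Finset.Icc 1 (u + 2)).powersetCard 3 \ G.edges with hK
  have hstarK : starTriples s u ⊆ K := by
    intro e he
    rw [hK, Finset.mem_sdiff]
    refine ⟨starTriples_subset _ _ he, fun h => ?_⟩
    obtain ⟨i, hi, rfl⟩ := Finset.mem_image.1 he
    rw [Finset.mem_Icc] at hi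
    have := (hstar i (by omega) hi.2).1 h
    omega
  have hKcard : K.card = u - b := by
    rw [hK, Finset.card_sdiff_of_subset hsub, hE, Finset.card_powersetCard, Nat.card_Icc,
      Nat.add_sub_cancel, Nat.choose_succ_succ' (u + 1) 2, Nat.choose_succ_succ' u 1,
      Nat.choose_one_right]
    have : (u + 1).choose (2 + 1) = (u + 1).choose 3 := rfl
    have : u.choose (1 + 1) = u.choose 2 := rfl
    omega
  -- Of the `u - b` non-edges, `u - s` are star triples, so `s - b` remain for `X`.
  have hcard := Finset.card_sdiff_of_subset hstarK
  have hle := Finset.card_le_card hstarK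
  rw [card_starTriples, hKcard] at hcard hle
  refine ⟨K \ starTriples s u, by omega, ?_, ?_, ?_, fun i h1 h2 h => ?_⟩
  · rw [Finset.union_sdiff_of_subset hstarK, hK, Finset.sdiff_sdiff_eq_self hsub]
  · intro e he
    rw [Finset.mem_sdiff, hK, Finset.mem_sdiff, Finset.mem_powersetCard] at he
    obtain ⟨⟨⟨heV, hec⟩, heG⟩, hes⟩ := he
    obtain ⟨i, j, k, hij, hjk, rfl⟩ := exists_triple_of_card hec
    have hi := Finset.mem_Icc.1 (heV (show i ∈ ({i, j, k} : Finset ℕ) by simp))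
    have hk := Finset.mem_Icc.1 (heV (show k ∈ ({i, j, k} : Finset ℕ) by simp))
    refine ⟨i, j, k, hi.1, hij, hjk, ?_, hk.2, rfl⟩
    by_contra hj
    obtain rfl : j = u + 1 := by omega
    obtain rfl : k = u + 2 := by omega
    rw [mem_starTriples (by omega)] at hes
    exact heG ((hstar i hi.1 (by omega)).2 (by omega))
  · intro i j k hi hij hjk hj hk h
    rw [Finset.mem_sdiff, hK, Finset.mem_sdiff]
    exact ⟨⟨triple_mem_powersetCard hi hij hjk hk, h⟩, notMem_starTriples hij hj⟩
  · by_contra hlt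
    exact h ((hstar i h1 h2).2 (by omega))

end RGraph

/-! ### Case analysis on the exceptional non-edges -/

theorem corollary3p8 (m t b : ℕ) (hm : 0 < m) (ht : 0 < t) (hb : 0 < b)
    (hlow : (t - 1).choose 3 + (t - 2).choose 2 + b < m) (hup : m ≤ t.choose 3)
    (G : RGraph 3) (hV : G.verts = Finset.Icc 1 t) (hE : G.edges.card = m)
    (hG : G.LeftCompressed) (hpair : (G.pairNbhd (t - 1) t).card ≤ b + 3) :
    G.lagrangian ≤ (colexGraph 3 m).lagrangian := by
  obtain ⟨u, rfl⟩ : ∃ u, t = u + 2 := by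
    refine ⟨t - 2, ?_⟩
    by_contra h
    obtain rfl : t = 1 := by omega
    have : Nat.choose 1 3 = 0 := rfl
    omega
  change (u + 1).choose 3 + u.choose 2 + b < m at hlow
  obtain ⟨c, hc⟩ : ∃ c, m = (u + 1).choose 3 + u.choose 2 + c := ⟨_, (Nat.add_sub_cancel'
    (show (u + 1).choose 3 + u.choose 2 ≤ m by omega)).symm⟩
  have hbc : b < c := by omega
  have hcu : c ≤ u := by
    rw [Nat.choose_succ_succ' (u + 1) 2, Nat.choose_succ_succ' u 1, Nat.choose_one_right] at hup
    have : (u + 1).choose (2 + 1) = (u + 1).choose 3 := rfl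
    have : u.choose (1 + 1) = u.choose 2 := rfl
    omega
  have hCV := verts_colexGraph hcu (by omega) hc
  have hCE : (colexGraph 3 m).edges = _ := colexEdges_eq_sdiff_starTriples hcu hc
  obtain ⟨X, hs, hGE, hX, hX', hstar⟩ := hG.exists_edges_eq hcu hV (hE.trans hc)
  change (G.pairNbhd (u + 1) (u + 2)).card ≤ b + 3 at hpair
  rw [hs] at hGE hstar hpair
  -- Since `c + X.card ≤ b + 3` and `b + 1 ≤ c`.
  have hX2 : X.card ≤ 2 := by omega
  rcases X.eq_empty_or_nonempty with rfl | ⟨e, he⟩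
  · rw [Finset.card_empty, add_zero, Finset.union_empty, ← hCE] at hGE
    rw [RGraph.eq_of_verts_of_edges (hV.trans hCV.symm) hGE]
  have hX1 : 1 ≤ X.card := Finset.card_pos.2 ⟨e, he⟩
  have hnE : ∀ i j k, {i, j, k} ∈ X → {i, j, k} ∉ G.edges := by
    intro i j k h h'
    rw [hGE, Finset.mem_sdiff, Finset.mem_union, not_or] at h'
    exact h'.2.2 h
  obtain ⟨i, j, k, hi, hij, hjk, hj, hk, rfl⟩ := hX e he
  -- This triple is the componentwise largest one not containing both `u + 1` and `u + 2`, so it is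
  -- missing as soon as any such triple is.
  have hfirst : {u - 1, u, u + 2} ∈ X := by
    refine hX' _ _ _ (by omega) (by omega) (by omega) le_rfl le_rfl fun h => hnE i j k he ?_
    exact hG.triple_mem hV hi hij hjk hk (by omega) (by omega) (by omega) hj hk h
  -- Moving up once more, `{u - 1, u + 1, u + 2}` is missing too. This bounds `s` and ensures that
  -- the vertices of the deleted star triples are distinct from the vertices of `X`.
  have hcu1 : c + X.card < u - 1 := by
    refine hstar _ (by omega) (by omega) fun h => hnE _ _ _ hfirst ?_
    exact hG.triple_mem hV (by omega) (by omega) (by omega) le_rfl (by omega) (by omega) le_rfl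
      (by omega) le_rfl h
  obtain ⟨v, rfl⟩ : ∃ v, u = v + 2 := ⟨u - 2, by omega⟩
  change {v + 1, v + 2, v + 4} ∈ X at hfirst
  rcases (show X.card = 1 ∨ X.card = 2 by omega) with hcard | hcard
  · obtain ⟨f, rfl⟩ := Finset.card_eq_one.1 hcard
    rw [Finset.mem_singleton] at hfirst
    subst hfirst
    exact RGraph.lagrangian_le_of_missing_triple (by omega) hV hCV hCE hGE
  obtain ⟨f, hf, hfne⟩ : ∃ f ∈ X, f ≠ {v + 1, v + 2, v + 4} :=
    Finset.exists_mem_ne (by omega) _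
  have hXeq : ∀ g ∈ X, g ≠ {v + 1, v + 2, v + 4} → X = {{v + 1, v + 2, v + 4}, g} := by
    intro g hg hne
    refine (Finset.eq_of_subset_of_card_le ?_ ?_).symm
    · exact Finset.insert_subset hfirst (Finset.singleton_subset_iff.2 hg)
    · rw [hcard, Finset.card_pair hne.symm]
  obtain ⟨i, j, k, hi, hij, hjk, hj, hk, rfl⟩ := hX f hf
  rw [hcard] at hGE hcu1
  -- The second exceptional non-edge lies below `{v, v + 2, v + 4}` if it contains the last vertex,
  -- and below `{v + 1, v + 2, v + 3}` otherwise; by up-closure that triple is missing, and as `X`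
  -- has only two elements it is the second one.
  by_cases hk4 : k = v + 4
  · subst hk4
    have hi' : i ≤ v := by
      by_contra hlt
      obtain rfl : i = v + 1 := by omega
      obtain rfl : j = v + 2 := by omega
      exact hfne rfl
    obtain ⟨w, rfl⟩ : ∃ w, v = w + 1 := ⟨v - 1, by omega⟩
    have hsecond : {w + 1, w + 3, w + 5} ∈ X := by
      refine hX' _ _ _ (by omega) (by omega) (by omega) le_rfl le_rfl fun h => hnE _ _ _ hf ?_
      exact hG.triple_mem hV hi hij hjk hk (by omega) (by omega) hi' hj le_rfl h
    -- Here `X` reaches down to `w + 1`, so the room for the deleted star triples has to be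
    -- recovered from the second non-edge.
    have hcw : c + X.card < w + 1 := by
      refine hstar _ (by omega) (by omega) fun h => hnE _ _ _ hsecond ?_
      exact hG.triple_mem hV (by omega) (by omega) (by omega) le_rfl (by omega) (by omega) le_rfl
        (by omega) le_rfl h
    have hne : ({w + 1, w + 3, w + 5} : Finset ℕ) ≠ {w + 2, w + 3, w + 5} := by
      intro h
      have : w + 1 ∈ ({w + 2, w + 3, w + 5} : Finset ℕ) := h ▸ by simp
      simp at this
    rw [hXeq _ hsecond hne, Finset.pair_comm] at hGE
    exact RGraph.lagrangian_le_of_missing_path (by omega) hV hCV hCE hGE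
  · have hsecond : {v + 1, v + 2, v + 3} ∈ X := by
      refine hX' _ _ _ (by omega) (by omega) (by omega) le_rfl (by omega) fun h => hnE _ _ _ hf ?_
      exact hG.triple_mem hV hi hij hjk hk (by omega) (by omega) (by omega) hj (by omega) h
    have hne : ({v + 1, v + 2, v + 3} : Finset ℕ) ≠ {v + 1, v + 2, v + 4} := by
      intro h
      have : v + 3 ∈ ({v + 1, v + 2, v + 4} : Finset ℕ) := h ▸ by simp
      simp at this
    rw [hXeq _ hsecond hne] at hGE
    exact RGraph.lagrangian_le_of_missing_pair (by omega) hV hCV hCE hGE
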